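/- Let $1\le k\le n$. Equip $\mathbb R^{n,1}=\mathbb R^{n}\times\mathbb R$ with the scalar product $\langle Y,Z\rangle=\sum_{i\le n}y_iz_i-y_{n+1}z_{n+1}$. Let $P\subset\mathbb R^{n,1}$ be a spacelike affine hyperplane with timelike unit normal $N_0$ (so $\langle N_0,N_0\rangle=-1$), let $\Omega\subset P$ be a bounded connected nonempty relatively open set with smooth boundary, and let $u:\overline\Omega\to\mathbb R$ be smooth up to the boundary, such that the graph $$M=\{x+u(x)N_0 : x\in\overline\Omega\},\qquad \partial M=\{x+u(x)N_0 : x\in\partial\Omega\},$$ is spacelike (its induced metric is positive definite everywhere, including at $\partial M$). Let $N$ be a smooth timelike unit normal field of $M$, let $A$ be the shape operator, defined by $D_vN=A(v)$ for tangent vectors $v$, let $\lambda=(\lambda_1,\dots,\lambda_n)$ be its eigenvalues (the principal curvatures), and let $H_k=\sigma_k(\lambda)/\binom nk$ be the $k$-th mean curvature, where $\sigma_k$ is the $k$-th elementary symmetric polynomial. Suppose that $H_k$ is constant on $M$, that $\partial M\subset P$, and that $\langle N,N_0\rangle$ is equal to a constant $\theta_0$ along $\partial M$. Then either $M\subset P$,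 or $M$ is part of a hyperboloid. Precisely, in the second case there are $a\in P$, $r>0$ and $\varepsilon\in\{1,-1\}$ such that $|H_k|\,r^k=1$, $$M\subset\{Y : \langle Y-Q,Y-Q\rangle=-r^2\},\qquad Q=a-\varepsilon r|\theta_0|N_0,$$ $\Omega=\{x\in P : \langle x-a,x-a\rangle<r^2(\theta_0^2-1)\}$ is a ball in $P$, and $$u(x)=\varepsilon\left(\sqrt{r^2+\langle x-a,x-a\rangle}-r|\theta_0|\right)\quad\text{for all }x\in\overline\Omega.$$ -/

import Mathlib

open scoped ContDiff

noncomputable section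

/-- The space `ℝⁿ × ℝ` underlying the Minkowski space `ℝ^{n,1}`; the second factor is the time
coordinate `x_{n+1}`. -/
abbrev Mink (n : ℕ) : Type := EuclideanSpace ℝ (Fin n) × ℝ

/-- The Lorentzian scalar product `y₁z₁ + ⋯ + yₙzₙ - y_{n+1}z_{n+1}`. -/
def mdot {n : ℕ} (Y Z : Mink n) : ℝ := inner ℝ Y.1 Z.1 - Y.2 * Z.2

/-- The (two-sheeted) hyperboloid with centre `Q` and radius `r`. -/
def hyperboloid {n : ℕ} (Q : Mink n) (r : ℝ) : Set (Mink n) :=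
  {Y | mdot (Y - Q) (Y - Q) = -r ^ 2}

/-- `P` is a spacelike (affine) hyperplane: it is nonempty, has dimension `n`, and the scalar
product is positive definite on its direction space. -/
structure IsSpacelikeHyperplane {n : ℕ} (P : AffineSubspace ℝ (Mink n)) : Prop where
  nonempty : (P : Set (Mink n)).Nonempty
  finrank_direction : Module.finrank ℝ P.direction = n
  spacelike : ∀ v ∈ P.direction, v ≠ 0 → 0 < mdot v v

/-- `N₀` is a timelike unit normal vector of the hyperplane `P`. -/
structure IsTimelikeUnitNormal {n : ℕ} (P : AffineSubspace ℝ (Mink n)) (N₀ : Mink n) : Prop where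
  unit : mdot N₀ N₀ = -1
  normal : ∀ v ∈ P.direction, mdot N₀ v = 0

/-- The open set `Ω` has smooth boundary: near each boundary point it is the negative set of a
smooth local defining function whose differential does not vanish there. -/
def HasSmoothBoundary {F : Type*} [NormedAddCommGroup F] [NormedSpace ℝ F] (Ω : Set F) : Prop :=
  ∀ p ∈ frontier Ω, ∃ (U : Set F) (ρ : F → ℝ), IsOpen U ∧ p ∈ U ∧ ContDiffOn ℝ ∞ ρ U ∧
    fderiv ℝ ρ p ≠ 0 ∧ Ω ∩ U = {x ∈ U | ρ x < 0}

/-- A smooth bounded domain. -/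
structure IsSmoothBoundedDomain {F : Type*} [NormedAddCommGroup F] [NormedSpace ℝ F]
    (Ω : Set F) : Prop where
  isOpen : IsOpen Ω
  isConnected : IsConnected Ω
  isBounded : Bornology.IsBounded Ω
  smoothBoundary : HasSmoothBoundary Ω

/-- The graph parametrization `x ↦ x + u(x) N₀` over `P`, where a point of `P` is written as
`p₀ + x` with a base point `p₀ ∈ P` and `x` in the direction space of `P`. -/
def graphMap {n : ℕ} {P : AffineSubspace ℝ (Mink n)} (p₀ N₀ : Mink n) (u : P.direction → ℝ)
    (x : P.direction) : Mink n :=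
  p₀ + (x : Mink n) + u x • N₀

section Hypersurface

variable {n : ℕ} {F : Type*} [NormedAddCommGroup F] [NormedSpace ℝ F]

/-- The map `X`, smooth on the parameter domain `D` (possibly including boundary points), is
spacelike: the induced metric is positive definite at every point of `D`. In particular `X` is
an immersion. -/
structure IsSpacelikeOn (X : F → Mink n) (D : Set F) : Prop where
  contDiffOn : ContDiffOn ℝ ∞ X D
  metric_pos : ∀ x ∈ D, ∀ v : F, v ≠ 0 →
    0 < mdot (fderivWithin ℝ X D x v) (fderivWithin ℝ X D x v)

/-- `N` is a smooth timelike unit normal field along `X` on `D`. -/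
structure IsUnitNormalField (X N : F → Mink n) (D : Set F) : Prop where
  contDiffOn : ContDiffOn ℝ ∞ N D
  unit : ∀ x ∈ D, mdot (N x) (N x) = -1
  normal : ∀ x ∈ D, ∀ v : F, mdot (N x) (fderivWithin ℝ X D x v) = 0

/-- The shape operator `A` at `x`, determined by `dN = dX ∘ A` (read in the parameter space,
which `dX` identifies with the tangent space of the hypersurface): since `dX` is injective and
the range of `dN` lies in that of `dX`, we may apply a left inverse of `dX`. -/
def shapeOperator (X N : F → Mink n) (D : Set F) (x : F) : F →ₗ[ℝ] F :=
  (fderivWithin ℝ X D x).toLinearMap.leftInverse ∘ₗ (fderivWithin ℝ N D x).toLinearMap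

variable [FiniteDimensional ℝ F]

/-- The principal curvatures: the eigenvalues of the shape operator, with multiplicity. -/
def principalCurvatures (X N : F → Mink n) (D : Set F) (x : F) : Multiset ℝ :=
  (shapeOperator X N D x).charpoly.roots

/-- The `k`-th mean curvature `σ_k(λ) / binom(n, k)`. -/
def meanCurvature (k : ℕ) (X N : F → Mink n) (D : Set F) (x : F) : ℝ :=
  (principalCurvatures X N D x).esymm k / (n.choose k : ℝ)

end Hypersurface

end

/-!
Lorentz coordinates `e : ℝⁿ → P.direction`, `(v, c) ↦ e v + c N₀`, turn the hypersurface into the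
graph of a function `u` on a domain `Ω` of `ℝⁿ`. After a change of sign the unit normal is
`N = (F, q)` with `q = √(1 + |F|²)`; then `∇u = F / q`, the shape operator is the Jacobian `A = DF`,
and on the boundary `u = 0` and `q = |θ₀| =: q₀` (`exists_isCappedGraph`). Let `T_j` denote the Newton
tensors of `A`. They are divergence free because `A` is a Jacobian (`diver_newtonTensor`), and this is
the source of all the identities used.

If `u` vanishes identically, the graph lies in `P`. Otherwise, replacing `u` by `-u` if necessary,
`u` is negative somewhere. A paraboloid touching the graph from below yields a point where `A` is
positive definite, so the constant `K = σ_k(A)` is positive, `K = binom(n, k) h^k` with `h > 0`. By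
the inequalities of Newton and Maclaurin the Gårding cone `σ_1, …, σ_k > 0` is relatively closed along
the graph, so `A` stays in it (`IsCappedGraph.sigma_pos`), and `T_{k-1}` is positive definite there
(`Multiset.esymm_pos_of_cons`). In particular `u < 0` in `Ω`.

*Maximum principle* (`IsCappedGraph.q_sub_le`). Put `M = 1 + F ⊗ F`. Then
`T_{k-1} M ∇(c u - q) = q T_{k-1}(c F - A F)`, and
`div T_{k-1}(c F - A F) = c k σ_k - (σ_1 σ_k - (k + 1) σ_{k+1})`. In the cone the bracket is at least
`h k σ_k`, so for `c < h` the function `c u - q` has no interior minimum. Letting `c → h` gives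
`q₀ - q ≥ h |u|`.

*Integral identity* (`IsCappedGraph.integral_identity`). The field
`(q - q₀) T_{k-1} x - u A T_{k-1} x` has divergence `(n - k + 1) σ_{k-1} (q - q₀) - k σ_k u`, and by
the maximum principle it is `O(q₀ - q)` at the boundary. Cutting it off along the level sets of
`q₀ - q` shows that the integral of its divergence is zero. By Maclaurin's inequality `(n - k + 1) σ_{k-1} h ≥ k σ_k`, so the divergence is a sum of two
nonpositive terms, both of which vanish; hence `q = q₀ + h u`.

*Rigidity.* Now `h u - q` is constant, so equality holds in the elliptic inequality, which forces
`A = h` (`IsCappedGraph.fderiv_eq_smul`). Integrating, `F = h (x - a)`, and `u = (q - q₀) / h` is a cap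
of a hyperboloid of radius `1 / h` over a ball.
-/

/-! ### Elementary symmetric functions of real numbers: the inequalities of Newton and Maclaurin -/

theorem Multiset.esymm_zero_right {R : Type*} [CommSemiring R] (s : Multiset R) :
    s.esymm 0 = 1 := by
  simp [Multiset.esymm]

theorem Multiset.esymm_cons_succ {R : Type*} [CommSemiring R] (a : R) (s : Multiset R) (j : ℕ) :
    (a ::ₘ s).esymm (j + 1) = s.esymm (j + 1) + a * s.esymm j := by
  simp only [Multiset.esymm, Multiset.powersetCard_cons, Multiset.map_add, Multiset.sum_add,
    Multiset.map_map, Function.comp_def, Multiset.prod_cons]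
  rw [Multiset.sum_map_mul_left]

theorem Multiset.esymm_eq_zero_of_card_lt {R : Type*} [CommSemiring R] {s : Multiset R} {j : ℕ}
    (h : s.card < j) : s.esymm j = 0 := by
  simp [Multiset.esymm, Multiset.powersetCard_eq_empty j h]

theorem Finset.esymm_insert {ι R : Type*} [DecidableEq ι] [CommSemiring R] (f : ι → R)
    {s : Finset ι} {a : ι} (ha : a ∉ s) (j : ℕ) :
    ((insert a s).val.map f).esymm (j + 1) =
      (s.val.map f).esymm (j + 1) + f a * (s.val.map f).esymm j := by
  rw [Finset.insert_val_of_notMem ha, Multiset.map_cons, Multiset.esymm_cons_succ]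

/-- Euler's identity for the homogeneous polynomial `σ_{j+1}`. -/
theorem Finset.sum_mul_esymm_erase {ι R : Type*} [DecidableEq ι] [CommSemiring R] (f : ι → R)
    (s : Finset ι) (j : ℕ) :
    ∑ i ∈ s, f i * ((s.erase i).val.map f).esymm j = (j + 1) * (s.val.map f).esymm (j + 1) := by
  induction s using Finset.induction_on generalizing j with
  | empty =>
    rw [Multiset.esymm_eq_zero_of_card_lt (by simp)]
    simp
  | insert a s ha ih =>
    rw [Finset.sum_insert ha, Finset.erase_insert ha, Finset.esymm_insert f ha]
    have hne : ∀ i ∈ s, (insert a s).erase i = insert a (s.erase i) := fun i hi =>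
      Finset.erase_insert_of_ne (fun h => ha (h ▸ hi))
    have hna : ∀ i, a ∉ s.erase i := fun i h => ha (Finset.mem_of_mem_erase h)
    cases j with
    | zero =>
      simp only [Multiset.esymm_zero_right, mul_one]
      have := ih 0
      simp only [Multiset.esymm_zero_right, mul_one] at this
      rw [this]; push_cast; ring
    | succ j =>
      have : ∑ i ∈ s, f i * (((insert a s).erase i).val.map f).esymm (j + 1) =
          ∑ i ∈ s, f i * ((s.erase i).val.map f).esymm (j + 1) +
            f a * ∑ i ∈ s, f i * ((s.erase i).val.map f).esymm j := by
        rw [Finset.mul_sum, ← Finset.sum_add_distrib]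
        refine Finset.sum_congr rfl fun i hi => ?_
        rw [hne i hi, Finset.esymm_insert f (hna i)]
        ring
      rw [this, ih, ih]
      push_cast; ring

theorem Multiset.esymm_pos {s : Multiset ℝ} (hs : ∀ a ∈ s, 0 < a) {j : ℕ} (hj : j ≤ s.card) :
    0 < s.esymm j := by
  induction s using Multiset.induction_on generalizing j with
  | empty =>
    obtain rfl : j = 0 := by simpa using hj
    rw [Multiset.esymm_zero_right]; exact one_pos
  | cons a s ih =>
    cases j with
    | zero => rw [Multiset.esymm_zero_right]; exact one_pos
    | succ j =>
      rw [Multiset.card_cons] at hj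
      have ha := hs a (Multiset.mem_cons_self a s)
      have hs' : ∀ b ∈ s, 0 < b := fun b hb => hs b (Multiset.mem_cons_of_mem hb)
      rw [Multiset.esymm_cons_succ]
      have h1 := mul_pos ha (ih hs' (show j ≤ s.card by omega))
      have h2 : 0 ≤ s.esymm (j + 1) := by
        rcases le_or_gt (j + 1) s.card with h | h
        · exact (ih hs' h).le
        · rw [Multiset.esymm_eq_zero_of_card_lt h]
      linarith

/-- Newton's inequality for the last three elementary symmetric functions. -/
theorem Multiset.newton_top (m : ℕ) (s : Multiset ℝ) (hs : s.card = m + 2) :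
    2 * (m + 2) * (s.esymm m * s.esymm (m + 2)) ≤ (m + 1) * s.esymm (m + 1) ^ 2 := by
  induction m generalizing s with
  | zero =>
    obtain ⟨a, b, rfl⟩ := Multiset.card_eq_two.1 hs
    have h1 : ({a, b} : Multiset ℝ).esymm (0 + 1) = a + b := Multiset.esymm_pair_one a b
    have h2 : ({a, b} : Multiset ℝ).esymm (0 + 2) = a * b := Multiset.esymm_pair_two a b
    rw [Multiset.esymm_zero_right, h1, h2]
    push_cast
    nlinarith [sq_nonneg (a - b)]
  | succ m ih =>
    obtain ⟨a, ha⟩ := Multiset.card_pos_iff_exists_mem.1 (by omega : 0 < s.card)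
    obtain ⟨t, rfl⟩ := Multiset.exists_cons_of_mem ha
    have ht : t.card = m + 2 := by simpa using hs
    have h0 : t.esymm (m + 3) = 0 := Multiset.esymm_eq_zero_of_card_lt (by omega)
    have h := ih t ht
    rw [show m + 1 + 2 = m + 2 + 1 by ring, Multiset.esymm_cons_succ, Multiset.esymm_cons_succ,
      Multiset.esymm_cons_succ, show t.esymm (m + 2 + 1) = 0 from h0]
    change 2 * (((m + 1 : ℕ) : ℝ) + 2) * ((t.esymm (m + 1) + a * t.esymm m) *
      (0 + a * t.esymm (m + 2))) ≤
      (((m + 1 : ℕ) : ℝ) + 1) * (t.esymm (m + 2) + a * t.esymm (m + 1)) ^ 2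
    push_cast
    generalize t.esymm (m + 2) = x at h ⊢
    generalize t.esymm (m + 1) = y at h ⊢
    generalize t.esymm m = z at h ⊢
    have hm : (0 : ℝ) ≤ m := m.cast_nonneg
    have h2 : 0 ≤ ((m : ℝ) + 3) * a ^ 2 * ((m + 1) * y ^ 2 - 2 * (m + 2) * (z * x)) :=
      mul_nonneg (by positivity) (by linarith)
    have h3 : 0 ≤ ((m : ℝ) + 2) * ((m + 1 + 1) * (x + a * y) ^ 2 -
        2 * (m + 1 + 2) * ((y + a * z) * (0 + a * x))) := by
      nlinarith [sq_nonneg ((m + 2) * x - a * y)]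
    linarith [nonneg_of_mul_nonneg_right h3 (by positivity)]

/-- By Rolle's theorem the derivative of `∏ (X + a)` is again a product of real linear factors;
its elementary symmetric functions are those of `s` up to a factor. -/
theorem Multiset.exists_esymm_derivative (n : ℕ) (s : Multiset ℝ) (hs : s.card = n + 1) :
    ∃ t : Multiset ℝ, t.card = n ∧
      ∀ j ≤ n, (n + 1) * t.esymm j = (n + 1 - j) * s.esymm j := by
  open Polynomial in
  set p : ℝ[X] := (s.map fun a => X + C a).prod with hp
  have hdeg : p.natDegree = n + 1 := by
    rw [hp, natDegree_multiset_prod_of_monic]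
    · simp [hs, add_comm]
    · intro f hf
      obtain ⟨a, -, rfl⟩ := Multiset.mem_map.1 hf
      exact monic_X_add_C a
  have hroots : p.roots.card = n + 1 := by
    have : p.Splits := by
      refine Splits.multisetProd fun f hf => ?_
      obtain ⟨a, -, rfl⟩ := Multiset.mem_map.1 hf
      exact Splits.X_add_C a
    rw [splits_iff_card_roots.1 this, hdeg]
  have hdd : (derivative p).natDegree = n := by
    rw [natDegree_derivative, hdeg, Nat.add_sub_cancel]
  have hsplit : (derivative p).Splits := by
    rw [splits_iff_card_roots]
    refine le_antisymm (card_roots' _) ?_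
    have := card_roots_le_derivative p
    omega
  have hcard : (derivative p).roots.card = n := by
    rw [splits_iff_card_roots.1 hsplit, hdd]
  have hcoeff : ∀ j ≤ n, (derivative p).coeff (n - j) = (n + 1 - j) * s.esymm j := by
    intro j hj
    rw [coeff_derivative, hp, Multiset.prod_X_add_C_coeff _ (by omega), hs,
      show n + 1 - (n - j + 1) = j by omega, Nat.cast_sub hj]
    ring
  have hlead : (derivative p).leadingCoeff = n + 1 := by
    rw [leadingCoeff, hdd]
    simpa [Multiset.esymm_zero_right] using hcoeff 0 (Nat.zero_le _)
  refine ⟨(derivative p).roots.map Neg.neg, by simpa using hcard, fun j hj => ?_⟩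
  rw [← hcoeff j hj, coeff_eq_esymm_roots_of_splits hsplit (by omega), hlead, hdd,
    show n - (n - j) = j by omega, Multiset.esymm_neg]
  ring

/-- The normalized elementary symmetric function `σ_j / binom(n, j)` of `n` real numbers. -/
noncomputable def Multiset.esymmMean (s : Multiset ℝ) (j : ℕ) : ℝ := s.esymm j / (s.card.choose j)

/-- Newton's inequality. -/
theorem Multiset.newton (s : Multiset ℝ) (j : ℕ) :
    s.esymmMean j * s.esymmMean (j + 2) ≤ s.esymmMean (j + 1) ^ 2 := by
  obtain ⟨d, hd⟩ | h : (∃ d, s.card = j + 2 + d) ∨ s.card < j + 2 := by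
    rcases lt_or_ge s.card (j + 2) with h | h
    · exact Or.inr h
    · exact Or.inl ⟨s.card - (j + 2), by omega⟩
  · induction d generalizing s with
    | zero =>
      have h := Multiset.newton_top j s hd
      have c1 : ((j + 2).choose (j + 1) : ℝ) = j + 2 := by
        rw [Nat.choose_succ_self_right]; push_cast; ring
      have c2 : ((j + 2).choose j : ℝ) = (j + 2) * (j + 1) / 2 := by
        rw [Nat.choose_symm_add, Nat.cast_choose_two]; push_cast; ring
      simp only [Multiset.esymmMean, hd, add_zero, c1, c2, Nat.choose_self, Nat.cast_one, div_one]
      rw [div_pow, div_mul_eq_mul_div, div_le_div_iff₀ (by positivity) (by positivity)]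
      have : 0 ≤ ((j : ℝ) + 2) * ((j + 1) * s.esymm (j + 1) ^ 2 -
          2 * (j + 2) * (s.esymm j * s.esymm (j + 2))) :=
        mul_nonneg (by positivity) (by linarith)
      nlinarith
    | succ d ih =>
      obtain ⟨t, ht, hst⟩ := Multiset.exists_esymm_derivative (j + 2 + d) s hd
      have key : ∀ i ≤ j + 2 + d, t.esymmMean i = s.esymmMean i := by
        intro i hi
        have h1 := hst i hi
        have h2 : ((j + 2 + d + 1).choose i : ℝ) * (j + 2 + d + 1 - i) =
            (j + 2 + d + 1) * (j + 2 + d).choose i := by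
          have := Nat.choose_mul_succ_eq (j + 2 + d) i
          have hc : ((j + 2 + d + 1 - i : ℕ) : ℝ) = j + 2 + d + 1 - i := by
            rw [Nat.cast_sub (by omega)]; push_cast; ring
          rw [← hc]
          exact_mod_cast (this.symm.trans (mul_comm _ _))
        have p1 : (0 : ℝ) < (j + 2 + d).choose i := by exact_mod_cast Nat.choose_pos hi
        have p2 : (0 : ℝ) < (j + 2 + d + 1).choose i := by
          exact_mod_cast Nat.choose_pos (by omega)
        have hd' : s.card = j + 2 + d + 1 := hd
        rw [Multiset.esymmMean, Multiset.esymmMean, ht, hd', div_eq_div_iff p1.ne' p2.ne']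
        have p3 : (0 : ℝ) < j + 2 + d + 1 := by positivity
        refine mul_left_cancel₀ p3.ne' ?_
        push_cast at h1
        calc _ = ((j + 2 + d + 1) * t.esymm i) * (j + 2 + d + 1).choose i := by ring
          _ = s.esymm i * (((j + 2 + d + 1).choose i : ℝ) * (j + 2 + d + 1 - i)) := by
            rw [h1]; ring
          _ = _ := by rw [h2]; ring
      rw [← key j (by omega), ← key (j + 1) (by omega), ← key (j + 2) (by omega)]
      exact ih t ht
  · rw [Multiset.esymmMean, Multiset.esymmMean, Multiset.esymm_eq_zero_of_card_lt h, zero_div,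
      mul_zero]
    positivity

/-- The weak form of Newton's inequality: the elementary symmetric functions are log-concave. -/
theorem Multiset.esymm_logConcave (s : Multiset ℝ) (j : ℕ) :
    s.esymm j * s.esymm (j + 2) ≤ s.esymm (j + 1) ^ 2 := by
  rcases lt_or_ge s.card (j + 2) with h | h
  · rw [Multiset.esymm_eq_zero_of_card_lt h, mul_zero]; positivity
  rcases le_or_gt (s.esymm j * s.esymm (j + 2)) 0 with h0 | h0
  · exact h0.trans (sq_nonneg _)
  have hN := s.newton j
  have p0 : (0 : ℝ) < s.card.choose j := by exact_mod_cast Nat.choose_pos (by omega)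
  have p1 : (0 : ℝ) < s.card.choose (j + 1) := by exact_mod_cast Nat.choose_pos (by omega)
  have p2 : (0 : ℝ) < s.card.choose (j + 2) := by exact_mod_cast Nat.choose_pos (by omega)
  have e1 : (s.card.choose (j + 1) : ℝ) * (j + 1) = s.card.choose j * (s.card - j) := by
    have := Nat.choose_succ_right_eq s.card j
    rw [← Nat.cast_sub (by omega)]; exact_mod_cast this
  have e2 : (s.card.choose (j + 2) : ℝ) * (j + 2) =
      s.card.choose (j + 1) * (s.card - j - 1) := by
    have := Nat.choose_succ_right_eq s.card (j + 1)
    have hc : ((s.card - (j + 1) : ℕ) : ℝ) = s.card - j - 1 := by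
      rw [Nat.cast_sub (by omega)]; push_cast; ring
    rw [← hc]; exact_mod_cast this
  have hcard : (j : ℝ) + 2 ≤ s.card := by exact_mod_cast h
  have hc : (s.card.choose j : ℝ) * s.card.choose (j + 2) ≤ (s.card.choose (j + 1) : ℝ) ^ 2 := by
    generalize (s.card.choose j : ℝ) = x at *
    generalize (s.card.choose (j + 1) : ℝ) = y at *
    generalize (s.card.choose (j + 2) : ℝ) = z at *
    generalize (s.card : ℝ) = n at *
    have hz : z ≤ y * ((n - j - 1) / (j + 2)) := by
      rw [← mul_div_assoc, le_div_iff₀ (by positivity)]; exact e2.le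
    have hx : x = y * ((j + 1) / (n - j)) := by
      rw [← mul_div_assoc, e1, mul_div_cancel_right₀]; linarith
    have : (j + 1) / (n - j) * ((n - j - 1) / (j + 2)) ≤ 1 := by
      rw [div_mul_div_comm, div_le_one (mul_pos (by linarith) (by positivity))]
      nlinarith
    calc x * z ≤ x * (y * ((n - j - 1) / (j + 2))) := by gcongr
      _ = y ^ 2 * ((j + 1) / (n - j) * ((n - j - 1) / (j + 2))) := by rw [hx]; ring
      _ ≤ y ^ 2 * 1 := by gcongr
      _ = _ := by ring
  simp only [Multiset.esymmMean] at hN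
  rw [div_mul_div_comm, div_pow, div_le_div_iff₀ (by positivity) (by positivity)] at hN
  have : s.esymm j * s.esymm (j + 2) * (s.card.choose (j + 1) : ℝ) ^ 2 ≤
      s.esymm (j + 1) ^ 2 * (s.card.choose (j + 1) : ℝ) ^ 2 :=
    hN.trans (by gcongr)
  exact le_of_mul_le_mul_right this (by positivity)

/-- Removing an element from a multiset in the Gårding cone `{σ_1, …, σ_{k+1} > 0}` leaves a
multiset in the cone `{σ_1, …, σ_k > 0}`. -/
theorem Multiset.esymm_pos_of_cons {a : ℝ} {t : Multiset ℝ} {k : ℕ}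
    (h : ∀ j ≤ k + 1, 0 < (a ::ₘ t).esymm j) : ∀ j ≤ k, 0 < t.esymm j := by
  intro j hj
  induction j using Nat.strong_induction_on with
  | _ j ih =>
  cases j with
  | zero => rw [Multiset.esymm_zero_right]; exact one_pos
  | succ j =>
    have hp := ih j (by omega) (by omega)
    have h1 := h (j + 1) (by omega)
    have h2 := h (j + 2) (by omega)
    rw [Multiset.esymm_cons_succ] at h1 h2
    have hN := t.esymm_logConcave j
    by_contra! hneg
    generalize t.esymm j = x at *
    change 0 < t.esymm (j + 2) + a * t.esymm (j + 1) at h2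
    generalize t.esymm (j + 1) = y at *
    generalize t.esymm (j + 2) = z at *
    nlinarith

/-- For a log-concave sequence `p` with `p 0 = 1` the ratios `p (j + 1) / p j` decrease, so they
are at most `p 1`. -/
theorem LogConcave.succ_le {p : ℕ → ℝ} (hp : ∀ j, p j * p (j + 2) ≤ p (j + 1) ^ 2)
    (h0 : p 0 = 1) {j : ℕ} (hpos : ∀ i ≤ j, 0 < p i) : p (j + 1) ≤ p 1 * p j := by
  induction j with
  | zero => simp [h0]
  | succ j ih =>
    have h1 := ih fun i hi => hpos i (by omega)
    have h2 := hpos (j + 1) le_rfl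
    have h3 := hpos j (by omega)
    refine le_of_mul_le_mul_left (a := p j) ?_ h3
    calc p j * p (j + 2) ≤ p (j + 1) * p (j + 1) := (hp j).trans_eq (sq _)
      _ ≤ (p 1 * p j) * p (j + 1) := by gcongr
      _ = _ := by ring

theorem LogConcave.pow_succ_le {p : ℕ → ℝ} (hp : ∀ j, p j * p (j + 2) ≤ p (j + 1) ^ 2)
    (h0 : p 0 = 1) {j : ℕ} (hpos : ∀ i ≤ j + 1, 0 < p i) : p (j + 1) ^ j ≤ p j ^ (j + 1) := by
  induction j with
  | zero => simp [h0]
  | succ j ih =>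
    have h1 := ih fun i hi => hpos i (by omega)
    have q0 := hpos j (by omega)
    have q1 := hpos (j + 1) (by omega)
    have q2 := hpos (j + 2) (by omega)
    refine le_of_mul_le_mul_left (a := p (j + 1) ^ j) ?_ (by positivity)
    calc p (j + 1) ^ j * p (j + 2) ^ (j + 1) ≤ p j ^ (j + 1) * p (j + 2) ^ (j + 1) := by gcongr
      _ = (p j * p (j + 2)) ^ (j + 1) := by rw [mul_pow]
      _ ≤ (p (j + 1) ^ 2) ^ (j + 1) := by gcongr; exact hp j
      _ = _ := by ring

/-- If `p k = h ^ k`, then `p` lies above the geometric sequence `h ^ j` up to index `k`. -/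
theorem LogConcave.pow_le {p : ℕ → ℝ} (hp : ∀ j, p j * p (j + 2) ≤ p (j + 1) ^ 2)
    (h0 : p 0 = 1) {k : ℕ} (hpos : ∀ i ≤ k, 0 < p i) {h : ℝ} (hh : 0 < h) (hk : p k = h ^ k)
    {j : ℕ} (hj : j ≤ k) : h ^ j ≤ p j := by
  induction hj using Nat.decreasingInduction with
  | self => exact hk.ge
  | of_succ j hj ih =>
    have h1 := LogConcave.pow_succ_le hp h0 (j := j) fun i hi => hpos i (by omega)
    refine le_of_pow_le_pow_left₀ (n := j + 1) (by omega) (hpos j hj.le).le ?_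
    calc (h ^ j) ^ (j + 1) = (h ^ (j + 1)) ^ j := by ring
      _ ≤ p (j + 1) ^ j := by gcongr
      _ ≤ _ := h1

theorem Multiset.esymmMean_zero (s : Multiset ℝ) : s.esymmMean 0 = 1 := by
  simp [Multiset.esymmMean, Multiset.esymm_zero_right]

theorem Multiset.esymmMean_mul_choose (s : Multiset ℝ) (j : ℕ) :
    s.esymmMean j * s.card.choose j = s.esymm j := by
  rcases le_or_gt j s.card with h | h
  · have : (s.card.choose j : ℝ) ≠ 0 := by exact_mod_cast (Nat.choose_pos h).ne'
    rw [Multiset.esymmMean, div_mul_cancel₀ _ this]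
  · rw [Multiset.esymm_eq_zero_of_card_lt h, Nat.choose_eq_zero_of_lt h, Nat.cast_zero, mul_zero]

theorem Multiset.esymmMean_pos {s : Multiset ℝ} {k : ℕ} (hk : k ≤ s.card)
    (hpos : ∀ j ≤ k, 0 < s.esymm j) : ∀ j ≤ k, 0 < s.esymmMean j := fun j hj =>
  div_pos (hpos j hj) (by exact_mod_cast Nat.choose_pos (hj.trans hk))

/-- Maclaurin's inequality in the Gårding cone. -/
theorem Multiset.maclaurin {s : Multiset ℝ} {k : ℕ} (hk : k ≤ s.card)
    (hpos : ∀ j ≤ k, 0 < s.esymm j) {h : ℝ} (hh : 0 < h)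
    (hs : s.esymm k = s.card.choose k * h ^ k) {j : ℕ} (hj : j ≤ k) :
    s.card.choose j * h ^ j ≤ s.esymm j := by
  have hc : (0 : ℝ) < s.card.choose k := by exact_mod_cast Nat.choose_pos hk
  rw [← s.esymmMean_mul_choose, mul_comm]
  gcongr
  refine LogConcave.pow_le s.newton s.esymmMean_zero (Multiset.esymmMean_pos hk hpos) hh ?_ hj
  rw [Multiset.esymmMean, hs, mul_div_cancel_left₀ _ hc.ne']

theorem Multiset.esymm_one (s : Multiset ℝ) : s.esymm 1 = s.sum := by
  simp [Multiset.esymm, Multiset.powersetCard_one]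

theorem Multiset.sum_sq_eq (s : Multiset ℝ) :
    (s.map fun a => a ^ 2).sum = s.esymm 1 ^ 2 - 2 * s.esymm 2 := by
  induction s using Multiset.induction_on with
  | empty =>
    rw [Multiset.esymm_eq_zero_of_card_lt (by simp), Multiset.esymm_eq_zero_of_card_lt (by simp)]
    simp
  | cons a s ih =>
    rw [Multiset.map_cons, Multiset.sum_cons, ih, Multiset.esymm_cons_succ a s 1,
      Multiset.esymm_one, Multiset.esymm_one, Multiset.sum_cons]
    ring

theorem Multiset.maclaurin_gap {s : Multiset ℝ} {k : ℕ} (hk : k ≤ s.card) :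
    s.esymm 1 * s.esymm k - (k + 1) * s.esymm (k + 1) =
      s.card.choose k * ((s.card - k) * (s.esymmMean 1 * s.esymmMean k - s.esymmMean (k + 1)) +
        k * s.esymmMean 1 * s.esymmMean k) := by
  have e : (s.card.choose (k + 1) : ℝ) * (k + 1) = s.card.choose k * (s.card - k) := by
    have := Nat.choose_succ_right_eq s.card k
    rw [← Nat.cast_sub hk]; exact_mod_cast this
  rw [← s.esymmMean_mul_choose k, ← s.esymmMean_mul_choose (k + 1), ← s.esymmMean_mul_choose 1,
    Nat.choose_one_right]
  linear_combination (-s.esymmMean (k + 1)) * e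

/-- The lower bound for `σ_1 σ_k - (k + 1) σ_{k+1}` in terms of the `k`-th mean. -/
theorem Multiset.le_esymm_one_mul_sub {s : Multiset ℝ} {k : ℕ} (hk1 : 1 ≤ k) (hk : k ≤ s.card)
    (hpos : ∀ j ≤ k, 0 < s.esymm j) {h : ℝ} (hh : 0 < h)
    (hs : s.esymm k = s.card.choose k * h ^ k) :
    h * (k * s.esymm k) ≤ s.esymm 1 * s.esymm k - (k + 1) * s.esymm (k + 1) := by
  have hc : (0 : ℝ) < s.card.choose k := by exact_mod_cast Nat.choose_pos hk
  have hp := Multiset.esymmMean_pos hk hpos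
  have hpk : s.esymmMean k = h ^ k := by
    rw [Multiset.esymmMean, hs, mul_div_cancel_left₀ _ hc.ne']
  have h1 := LogConcave.pow_le s.newton s.esymmMean_zero hp hh hpk hk1
  rw [pow_one] at h1
  have h2 := LogConcave.succ_le s.newton s.esymmMean_zero hp
  have hkc : (k : ℝ) ≤ s.card := by exact_mod_cast hk
  have hkp := hp k le_rfl
  rw [Multiset.maclaurin_gap hk, ← s.esymmMean_mul_choose k]
  calc h * (k * (s.esymmMean k * s.card.choose k))
      = s.card.choose k * (0 + k * h * s.esymmMean k) := by ring
    _ ≤ _ := by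
      gcongr
      exact mul_nonneg (by linarith) (by linarith)

/-- The equality case of `Multiset.le_esymm_one_mul_sub`: all elements agree. -/
theorem Multiset.eq_of_esymm_one_mul_sub_eq {s : Multiset ℝ} {k : ℕ} (hk1 : 1 ≤ k)
    (hk : k ≤ s.card) (hpos : ∀ j ≤ k, 0 < s.esymm j) {h : ℝ} (hh : 0 < h)
    (hs : s.esymm k = s.card.choose k * h ^ k)
    (heq : s.esymm 1 * s.esymm k - (k + 1) * s.esymm (k + 1) = h * (k * s.esymm k)) :
    ∀ a ∈ s, a = h := by
  have hc : (0 : ℝ) < s.card.choose k := by exact_mod_cast Nat.choose_pos hk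
  have hp := Multiset.esymmMean_pos hk hpos
  have hpk : s.esymmMean k = h ^ k := by
    rw [Multiset.esymmMean, hs, mul_div_cancel_left₀ _ hc.ne']
  have h1 := LogConcave.pow_le s.newton s.esymmMean_zero hp hh hpk hk1
  rw [pow_one] at h1
  have h2 := LogConcave.succ_le s.newton s.esymmMean_zero hp
  have hkc : (k : ℝ) ≤ s.card := by exact_mod_cast hk
  have hk0 : (0 : ℝ) < k := by exact_mod_cast hk1
  have hkp := hp k le_rfl
  rw [Multiset.maclaurin_gap hk, ← s.esymmMean_mul_choose k] at heq
  have heq' : (s.card - k) * (s.esymmMean 1 * s.esymmMean k - s.esymmMean (k + 1)) +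
      k * s.esymmMean k * (s.esymmMean 1 - h) = 0 := by
    refine mul_left_cancel₀ hc.ne' ?_
    linear_combination heq
  have n1 : 0 ≤ (s.card - k : ℝ) * (s.esymmMean 1 * s.esymmMean k - s.esymmMean (k + 1)) :=
    mul_nonneg (by linarith) (by linarith)
  have n2 : 0 ≤ k * s.esymmMean k * (s.esymmMean 1 - h) :=
    mul_nonneg (by positivity) (by linarith)
  have e1 : s.esymmMean 1 = h := by
    have : k * s.esymmMean k * (s.esymmMean 1 - h) = 0 := by linarith
    rcases mul_eq_zero.1 this with h' | h'
    · exact absurd h' (by positivity)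
    · linarith
  have e2 : (s.card * (s.card - 1) / 2 : ℝ) * h ^ 2 ≤ s.esymm 2 := by
    rw [← s.esymmMean_mul_choose 2, Nat.cast_choose_two, mul_comm]
    rcases hk1.lt_or_eq with hk2 | rfl
    · have := LogConcave.pow_le s.newton s.esymmMean_zero hp hh hpk hk2
      have : (0 : ℝ) ≤ s.card * (s.card - 1) / 2 := by
        have : (1 : ℝ) < s.card := by exact_mod_cast hk2.trans_le hk
        exact div_nonneg (mul_nonneg (by linarith) (by linarith)) (by norm_num)
      gcongr
    · have h3 : (s.card - (1 : ℕ) : ℝ) * (s.esymmMean 1 * s.esymmMean 1 - s.esymmMean (1 + 1)) = 0 := by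
        linarith
      rw [e1] at h3
      push_cast at h3
      change (s.card - 1 : ℝ) * (h * h - s.esymmMean 2) = 0 at h3
      refine le_of_eq ?_
      linear_combination (s.card : ℝ) / 2 * h3
  have e3 : s.esymm 1 = s.card * h := by
    rw [← s.esymmMean_mul_choose 1, e1, Nat.choose_one_right, mul_comm]
  have e4 : (s.map fun a => (a - h) ^ 2).sum ≤ 0 := by
    have : (s.map fun a => (a - h) ^ 2).sum =
        (s.map fun a => a ^ 2).sum - 2 * h * s.sum + s.card * h ^ 2 := by
      have hfun : (fun a : ℝ => (a - h) ^ 2) = fun a => a ^ 2 - 2 * h * a + h ^ 2 := by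
        funext a; ring
      rw [hfun, Multiset.sum_map_add, Multiset.sum_map_sub, Multiset.sum_map_mul_left,
        Multiset.map_id', Multiset.map_const', Multiset.sum_replicate, nsmul_eq_mul]
    rw [this, Multiset.sum_sq_eq, ← Multiset.esymm_one, e3]
    nlinarith
  intro a ha
  have hle : (a - h) ^ 2 ≤ (s.map fun a => (a - h) ^ 2).sum :=
    Multiset.single_le_sum (by simp only [Multiset.mem_map]; rintro _ ⟨b, -, rfl⟩; positivity) _
      (Multiset.mem_map_of_mem _ ha)
  have : (a - h) ^ 2 = 0 := le_antisymm (hle.trans e4) (sq_nonneg _)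
  exact sub_eq_zero.1 (pow_eq_zero_iff (by norm_num) |>.1 this)

/-! ### Elementary symmetric functions and Newton tensors of an operator -/

section NewtonTensor

variable {V : Type*} [NormedAddCommGroup V] [InnerProductSpace ℝ V] [FiniteDimensional ℝ V]

/-- The trace as a continuous linear functional on the operators of a finite-dimensional space. -/
noncomputable def opTrace : (V →L[ℝ] V) →L[ℝ] ℝ :=
  LinearMap.toContinuousLinearMap (LinearMap.trace ℝ V ∘ₗ ContinuousLinearMap.coeLM ℝ)

theorem opTrace_apply (A : V →L[ℝ] V) : opTrace A = LinearMap.trace ℝ V (A : V →ₗ[ℝ] V) := rfl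

theorem opTrace_mul_comm (A B : V →L[ℝ] V) : opTrace (A * B) = opTrace (B * A) := by
  rw [opTrace_apply, opTrace_apply]
  exact LinearMap.trace_mul_comm ℝ (A : V →ₗ[ℝ] V) (B : V →ₗ[ℝ] V)

theorem opTrace_one : opTrace (1 : V →L[ℝ] V) = Module.finrank ℝ V := by
  rw [opTrace_apply]
  exact LinearMap.trace_one ℝ V

theorem opTrace_smulRight (f : V →L[ℝ] ℝ) (v : V) : opTrace (f.smulRight v) = f v := by
  rw [opTrace_apply]
  exact LinearMap.trace_smulRight (f : V →ₗ[ℝ] ℝ) v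

theorem opTrace_eq_sum {ι : Type*} [Fintype ι] [DecidableEq ι] (b : Module.Basis ι ℝ V)
    {A : V →L[ℝ] V} {c : ι → ℝ} (h : ∀ i, A (b i) = c i • b i) : opTrace A = ∑ i, c i := by
  rw [opTrace_apply, LinearMap.trace_eq_matrix_trace ℝ b, Matrix.trace]
  refine Finset.sum_congr rfl fun i _ => ?_
  simp [LinearMap.toMatrix_apply, h]

/-- The Newton tensors of an operator, `T_0 = 1` and `T_{j+1} = σ_{j+1} - T_j A`, where
`(j + 1) σ_{j+1} = tr (T_j A)`. -/
noncomputable def newtonTensor (A : V →L[ℝ] V) : ℕ → V →L[ℝ] V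
  | 0 => 1
  | j + 1 => (opTrace (newtonTensor A j * A) / (j + 1)) • 1 - newtonTensor A j * A

/-- The `j`-th elementary symmetric function of the eigenvalues of an operator, defined through
traces of the Newton tensors so that it is visibly a smooth function of the operator. -/
noncomputable def opSigma (A : V →L[ℝ] V) : ℕ → ℝ
  | 0 => 1
  | j + 1 => opTrace (newtonTensor A j * A) / (j + 1)

theorem newtonTensor_zero (A : V →L[ℝ] V) : newtonTensor A 0 = 1 := rfl

theorem newtonTensor_succ (A : V →L[ℝ] V) (j : ℕ) :
    newtonTensor A (j + 1) = opSigma A (j + 1) • 1 - newtonTensor A j * A := rfl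

theorem opSigma_zero (A : V →L[ℝ] V) : opSigma A 0 = 1 := rfl

theorem opTrace_newtonTensor_mul (A : V →L[ℝ] V) (j : ℕ) :
    opTrace (newtonTensor A j * A) = (j + 1) * opSigma A (j + 1) := by
  rw [opSigma]
  field_simp

theorem newtonTensor_mul_comm (A : V →L[ℝ] V) (j : ℕ) :
    newtonTensor A j * A = A * newtonTensor A j := by
  induction j with
  | zero => simp [newtonTensor_zero]
  | succ j ih =>
    rw [newtonTensor_succ, sub_mul, mul_sub, ih, smul_one_mul, mul_smul_one, mul_assoc, ih]

theorem opTrace_newtonTensor (A : V →L[ℝ] V) (j : ℕ) :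
    opTrace (newtonTensor A j) = (Module.finrank ℝ V - j) * opSigma A j := by
  cases j with
  | zero => simp [newtonTensor_zero, opSigma_zero, opTrace_one]
  | succ j =>
    rw [newtonTensor_succ, map_sub, map_smul, opTrace_one, opTrace_newtonTensor_mul]
    push_cast
    simp only [smul_eq_mul]
    ring

theorem contDiff_newtonTensor (j : ℕ) :
    ContDiff ℝ ∞ (fun A : V →L[ℝ] V => newtonTensor A j) := by
  induction j with
  | zero => exact contDiff_const
  | succ j ih =>
    have h : ContDiff ℝ ∞ fun A : V →L[ℝ] V => newtonTensor A j * A := ih.mul contDiff_id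
    have h' : ContDiff ℝ ∞ fun A : V →L[ℝ] V => opTrace (newtonTensor A j * A) :=
      (opTrace (V := V)).contDiff.comp h
    exact ((h'.div_const _).smul contDiff_const).sub h

theorem contDiff_opSigma (j : ℕ) : ContDiff ℝ ∞ (fun A : V →L[ℝ] V => opSigma A j) := by
  cases j with
  | zero => exact contDiff_const
  | succ j =>
    have h : ContDiff ℝ ∞ fun A : V →L[ℝ] V => opTrace (newtonTensor A j * A) :=
      (opTrace (V := V)).contDiff.comp ((contDiff_newtonTensor j).mul contDiff_id)
    exact h.div_const _

/-- The operators `C_{j,m}`, polynomials in `A`, for which `tr (dT_j[B] A^m) = tr (C_{j,m} B)`,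
where `dT_j[B]` is the derivative of `A ↦ T_j(A)` in the direction `B`. -/
noncomputable def newtonAux (A : V →L[ℝ] V) : ℕ → ℕ → V →L[ℝ] V
  | 0, _ => 0
  | j + 1, m => opTrace (A ^ m) • newtonTensor A j - newtonAux A j (m + 1) -
      A ^ m * newtonTensor A j

theorem newtonAux_add (A : V →L[ℝ] V) (j m : ℕ) :
    newtonAux A (j + 1) m + newtonAux A j m * A =
      opTrace (newtonTensor A j * A ^ m) • 1 - newtonTensor A j * A ^ m := by
  induction j generalizing m with
  | zero => simp [newtonAux, newtonTensor_zero]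
  | succ j ih =>
    have h := ih (m + 1)
    have e : newtonTensor A (j + 1) * A ^ m =
        opSigma A (j + 1) • A ^ m - newtonTensor A j * A ^ (m + 1) := by
      rw [newtonTensor_succ, sub_mul, smul_one_mul, mul_assoc, ← pow_succ']
    have e2 : A ^ m * newtonTensor A (j + 1) =
        opSigma A (j + 1) • A ^ m - A ^ m * (newtonTensor A j * A) := by
      rw [newtonTensor_succ, mul_sub, mul_smul_one]
    have e3 : opTrace (newtonTensor A (j + 1) * A ^ m) =
        opSigma A (j + 1) * opTrace (A ^ m) - opTrace (newtonTensor A j * A ^ (m + 1)) := by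
      rw [e, map_sub, map_smul, smul_eq_mul]
    rw [e3, e, newtonAux, e2, newtonTensor_succ]
    have h' : newtonAux A (j + 1) (m + 1) = opTrace (newtonTensor A j * A ^ (m + 1)) • 1 -
        newtonTensor A j * A ^ (m + 1) - newtonAux A j (m + 1) * A := by
      rw [← h]; abel
    rw [h']
    have e4 : newtonAux A (j + 1) m * A = opTrace (A ^ m) • (newtonTensor A j * A) -
        newtonAux A j (m + 1) * A - A ^ m * (newtonTensor A j * A) := by
      rw [newtonAux, sub_mul, sub_mul, smul_mul_assoc, mul_assoc]
    rw [e4]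
    module

theorem newtonAux_one (A : V →L[ℝ] V) (j : ℕ) :
    newtonAux A j 1 = (j : ℝ) • newtonTensor A j := by
  induction j with
  | zero => simp [newtonAux]
  | succ j ih =>
    have h := newtonAux_add A j 1
    rw [ih, pow_one, opTrace_newtonTensor_mul] at h
    rw [eq_sub_of_add_eq h, newtonTensor_succ, smul_mul_assoc]
    push_cast
    module

theorem hasFDerivAt_newtonTensor (A : V →L[ℝ] V) (j : ℕ) :
    HasFDerivAt (fun A : V →L[ℝ] V => newtonTensor A j)
      (fderiv ℝ (fun A : V →L[ℝ] V => newtonTensor A j) A) A :=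
  ((contDiff_newtonTensor j).differentiable (by simp) A).hasFDerivAt

theorem hasFDerivAt_opSigma (A : V →L[ℝ] V) (j : ℕ) :
    HasFDerivAt (fun A : V →L[ℝ] V => opSigma A j)
      (fderiv ℝ (fun A : V →L[ℝ] V => opSigma A j) A) A :=
  ((contDiff_opSigma j).differentiable (by simp) A).hasFDerivAt

theorem fderiv_newtonTensor_succ (A B : V →L[ℝ] V) (j : ℕ) :
    fderiv ℝ (fun A : V →L[ℝ] V => newtonTensor A (j + 1)) A B =
      fderiv ℝ (fun A : V →L[ℝ] V => opSigma A (j + 1)) A B • 1 -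
        fderiv ℝ (fun A : V →L[ℝ] V => newtonTensor A j) A B * A - newtonTensor A j * B := by
  have h := ((hasFDerivAt_opSigma A (j + 1)).smul_const (1 : V →L[ℝ] V)).sub
    ((hasFDerivAt_newtonTensor A j).mul' (hasFDerivAt_id A))
  have h' : HasFDerivAt (fun A : V →L[ℝ] V => newtonTensor A (j + 1)) _ A := h
  rw [h'.fderiv]
  ext v
  simp
  abel

theorem fderiv_opSigma_succ_aux (A B : V →L[ℝ] V) (j : ℕ) :
    (j + 1) * fderiv ℝ (fun A : V →L[ℝ] V => opSigma A (j + 1)) A B =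
      opTrace (fderiv ℝ (fun A : V →L[ℝ] V => newtonTensor A j) A B * A) +
        opTrace (newtonTensor A j * B) := by
  have h1 : HasFDerivAt (fun A : V →L[ℝ] V => newtonTensor A j * A) _ A :=
    (hasFDerivAt_newtonTensor A j).mul' (hasFDerivAt_id A)
  have h2 : HasFDerivAt (fun A : V →L[ℝ] V => opTrace (newtonTensor A j * A)) _ A :=
    (opTrace (V := V)).hasFDerivAt.comp A h1
  have h3 := (hasFDerivAt_opSigma A (j + 1)).const_mul ((j : ℝ) + 1)
  simp only [← opTrace_newtonTensor_mul] at h3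
  have h4 := DFunLike.congr_fun (h3.unique h2) B
  rw [smul_apply, smul_eq_mul] at h4
  rw [h4, ContinuousLinearMap.comp_apply, ← map_add, add_comm]
  rfl

/-- The derivative of `σ_{j+1}` is paired with `T_j`. -/
theorem fderiv_opSigma_succ (A B : V →L[ℝ] V) (j : ℕ) :
    fderiv ℝ (fun A : V →L[ℝ] V => opSigma A (j + 1)) A B = opTrace (newtonTensor A j * B) := by
  suffices h : ∀ j, (∀ m, opTrace (fderiv ℝ (fun A : V →L[ℝ] V => newtonTensor A j) A B * A ^ m) =
      opTrace (newtonAux A j m * B)) ∧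
      fderiv ℝ (fun A : V →L[ℝ] V => opSigma A (j + 1)) A B = opTrace (newtonTensor A j * B) from
    (h j).2
  intro j
  have step : ∀ j, (∀ m, opTrace (fderiv ℝ (fun A : V →L[ℝ] V => newtonTensor A j) A B * A ^ m) =
      opTrace (newtonAux A j m * B)) →
      fderiv ℝ (fun A : V →L[ℝ] V => opSigma A (j + 1)) A B =
        opTrace (newtonTensor A j * B) := by
    intro j hj
    have h1 := hj 1
    have h2 := fderiv_opSigma_succ_aux A B j
    rw [newtonAux_one, pow_one, smul_mul_assoc, map_smul, smul_eq_mul] at h1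
    rw [h1] at h2
    refine mul_left_cancel₀ (by positivity : (j : ℝ) + 1 ≠ 0) ?_
    rw [h2]; ring
  induction j with
  | zero =>
    have : ∀ m, opTrace (fderiv ℝ (fun A : V →L[ℝ] V => newtonTensor A 0) A B * A ^ m) =
        opTrace (newtonAux A 0 m * B) := by
      intro m
      simp [newtonTensor_zero, newtonAux]
    exact ⟨this, step 0 this⟩
  | succ j ih =>
    have : ∀ m, opTrace (fderiv ℝ (fun A : V →L[ℝ] V => newtonTensor A (j + 1)) A B * A ^ m) =
        opTrace (newtonAux A (j + 1) m * B) := by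
      intro m
      have c : opTrace (newtonTensor A j * B * A ^ m) = opTrace (A ^ m * newtonTensor A j * B) := by
        rw [opTrace_mul_comm, mul_assoc]
      rw [fderiv_newtonTensor_succ, ih.2, sub_mul, sub_mul, smul_one_mul, map_sub, map_sub,
        mul_assoc _ A, ← pow_succ', ih.1, newtonAux, sub_mul, sub_mul, map_sub, map_sub, c,
        smul_mul_assoc, map_smul, map_smul, smul_eq_mul, smul_eq_mul, mul_comm]
    exact ⟨this, step (j + 1) this⟩

/-- The Newton tensors of a Jacobian are divergence free; here `D` plays the role of the second
derivative of the map, and only its symmetry matters. -/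
theorem opTrace_fderiv_newtonTensor_flip (A : V →L[ℝ] V) (D : V →L[ℝ] V →L[ℝ] V)
    (hD : ∀ v w, D v w = D w v) (j : ℕ) (v : V) :
    opTrace (((fderiv ℝ (fun A : V →L[ℝ] V => newtonTensor A j) A).comp D).flip v) = 0 := by
  induction j generalizing v with
  | zero =>
    have : (((fderiv ℝ (fun A : V →L[ℝ] V => newtonTensor A 0) A).comp D).flip v) = 0 := by
      ext w; simp [newtonTensor_zero]
    rw [this, map_zero]
  | succ j ih =>
    have : (((fderiv ℝ (fun A : V →L[ℝ] V => newtonTensor A (j + 1)) A).comp D).flip v) =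
        ((fderiv ℝ (fun A : V →L[ℝ] V => opSigma A (j + 1)) A).comp D).smulRight v -
        (((fderiv ℝ (fun A : V →L[ℝ] V => newtonTensor A j) A).comp D).flip (A v)) -
        newtonTensor A j * D v := by
      ext w
      simp [fderiv_newtonTensor_succ, hD v w]
    rw [this, map_sub, map_sub, ih, opTrace_smulRight, ContinuousLinearMap.comp_apply,
      fderiv_opSigma_succ, sub_zero, sub_self]

theorem opSigma_and_newtonTensor_smul (c : ℝ) (A : V →L[ℝ] V) (j : ℕ) :
    opSigma (c • A) j = c ^ j * opSigma A j ∧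
      newtonTensor (c • A) j = c ^ j • newtonTensor A j := by
  induction j with
  | zero => simp [opSigma_zero, newtonTensor_zero]
  | succ j ih =>
    have h1 : opSigma (c • A) (j + 1) = c ^ (j + 1) * opSigma A (j + 1) := by
      refine mul_left_cancel₀ (by positivity : (j : ℝ) + 1 ≠ 0) ?_
      rw [← opTrace_newtonTensor_mul, ih.2, smul_mul_smul_comm, ← pow_succ, map_smul,
        opTrace_newtonTensor_mul, smul_eq_mul]
      ring
    refine ⟨h1, ?_⟩
    rw [newtonTensor_succ, newtonTensor_succ, h1, ih.2, smul_mul_smul_comm, ← pow_succ, smul_sub,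
      smul_smul]

theorem opSigma_smul (c : ℝ) (A : V →L[ℝ] V) (j : ℕ) :
    opSigma (c • A) j = c ^ j * opSigma A j :=
  (opSigma_and_newtonTensor_smul c A j).1

end NewtonTensor

/-! ### Diagonalization of the shape operator -/

section Eigenbasis

variable {V : Type*} [NormedAddCommGroup V] [InnerProductSpace ℝ V] [FiniteDimensional ℝ V]
  {ι : Type*} [Fintype ι]

theorem opSigma_and_newtonTensor_of_eigenbasis [DecidableEq ι] {A : V →L[ℝ] V} (b : Module.Basis ι ℝ V)
    {l : ι → ℝ} (h : ∀ i, A (b i) = l i • b i) (j : ℕ) :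
    opSigma A j = (Finset.univ.val.map l).esymm j ∧
      ∀ i, newtonTensor A j (b i) = ((Finset.univ.erase i).val.map l).esymm j • b i := by
  induction j with
  | zero => simp [opSigma_zero, newtonTensor_zero, Multiset.esymm_zero_right]
  | succ j ih =>
    have h1 : opSigma A (j + 1) = (Finset.univ.val.map l).esymm (j + 1) := by
      refine mul_left_cancel₀ (by positivity : (j : ℝ) + 1 ≠ 0) ?_
      rw [← opTrace_newtonTensor_mul, ← Finset.sum_mul_esymm_erase]
      refine opTrace_eq_sum b fun i => ?_
      rw [mul_apply_eq_comp, h, map_smul, ih.2, smul_smul]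
    refine ⟨h1, fun i => ?_⟩
    have h2 := Finset.esymm_insert l (Finset.notMem_erase i Finset.univ) j
    rw [Finset.insert_erase (Finset.mem_univ i)] at h2
    rw [newtonTensor_succ, h1, h2, sub_apply, mul_apply_eq_comp, h, map_smul, ih.2]
    simp only [smul_apply, one_apply_eq_self]
    module

theorem opSigma_of_eigenbasis [DecidableEq ι] {A : V →L[ℝ] V} (b : Module.Basis ι ℝ V)
    {l : ι → ℝ} (h : ∀ i, A (b i) = l i • b i) (j : ℕ) :
    opSigma A j = (Finset.univ.val.map l).esymm j :=
  (opSigma_and_newtonTensor_of_eigenbasis b h j).1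

theorem newtonTensor_of_eigenbasis [DecidableEq ι] {A : V →L[ℝ] V} (b : Module.Basis ι ℝ V)
    {l : ι → ℝ} (h : ∀ i, A (b i) = l i • b i) (j : ℕ) (i : ι) :
    newtonTensor A j (b i) = ((Finset.univ.erase i).val.map l).esymm j • b i :=
  (opSigma_and_newtonTensor_of_eigenbasis b h j).2 i

theorem charpoly_roots_of_eigenbasis [DecidableEq ι] {A : V →ₗ[ℝ] V} (b : Module.Basis ι ℝ V)
    {l : ι → ℝ} (h : ∀ i, A (b i) = l i • b i) : A.charpoly.roots = Finset.univ.val.map l := by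
  have : LinearMap.toMatrix b b A = Matrix.diagonal l := by
    ext i j
    rw [LinearMap.toMatrix_apply, h, map_smul, Finsupp.smul_apply, b.repr_self,
      Matrix.diagonal_apply, Finsupp.single_apply]
    by_cases hij : i = j
    · simp [hij]
    · simp [hij, Ne.symm hij]
  rw [← LinearMap.charpoly_toMatrix A b, this, Matrix.charpoly_diagonal,
    ← Polynomial.roots_multiset_prod_X_sub_C (Finset.univ.val.map l), Multiset.map_map]
  rfl

open scoped InnerProductSpace

/-- The trace of `T M Q` when `T` is diagonal in a basis `b` and `M = ∑ b_i ⊗ b_i`. -/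
theorem opTrace_eq_sum_inner {T M Q : V →L[ℝ] V} (b : Module.Basis ι ℝ V) {c : ι → ℝ}
    (hT : ∀ i, T (b i) = c i • b i) (hM : ∀ w, M w = ∑ i, ⟪b i, w⟫_ℝ • b i) :
    opTrace (T * M * Q) = ∑ i, c i * ⟪b i, Q (b i)⟫_ℝ := by
  have : T * M * Q = ∑ i, ((innerSL ℝ (b i)).comp Q).smulRight (c i • b i) := by
    ext w
    simp [hM, hT]
  rw [this, map_sum]
  refine Finset.sum_congr rfl fun i _ => ?_
  rw [opTrace_smulRight]
  simp

/-- Diagonalization of the shape operator `A = q (1 + F ⊗ F) S` of a spacelike graph, where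
`S` is the Hessian. With `R = 1 + F ⊗ F / (1 + q)` one has `R² = 1 + F ⊗ F`, so `A` is conjugate
under `R` to the symmetric operator `q R S R`. -/
theorem exists_eigenbasis_graph {n : ℕ} (hn : Module.finrank ℝ V = n) {A S : V →L[ℝ] V} {F : V}
    {q : ℝ} (hq0 : 0 < q) (hq : q ^ 2 = 1 + ‖F‖ ^ 2) (hS : ∀ v w, ⟪S v, w⟫_ℝ = ⟪v, S w⟫_ℝ)
    (hA : ∀ v, A v = q • (S v + ⟪F, S v⟫_ℝ • F)) :
    ∃ (b : Module.Basis (Fin n) ℝ V) (l : Fin n → ℝ), (∀ i, A (b i) = l i • b i) ∧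
      (∀ w, w + ⟪F, w⟫_ℝ • F = ∑ i, ⟪b i, w⟫_ℝ • b i) ∧ ∀ i, l i = q * ⟪S (b i), b i⟫_ℝ := by
  set R : V →ₗ[ℝ] V := LinearMap.id + ((1 + q)⁻¹ • (innerₛₗ ℝ F)).smulRight F with hR
  have hRa : ∀ v, R v = v + ((1 + q)⁻¹ * ⟪F, v⟫_ℝ) • F := fun v => by simp [hR]
  have hFF : ⟪F, F⟫_ℝ = q ^ 2 - 1 := by rw [real_inner_self_eq_norm_sq, hq]; ring
  have hRR : ∀ v, R (R v) = v + ⟪F, v⟫_ℝ • F := by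
    intro v
    simp only [hRa, inner_add_right, inner_smul_right, hFF, add_assoc, ← add_smul]
    congr 2
    field_simp
    ring
  have hRs : ∀ v w, ⟪R v, w⟫_ℝ = ⟪v, R w⟫_ℝ := by
    intro v w
    simp only [hRa, inner_add_left, inner_add_right, inner_smul_left, inner_smul_right,
      real_inner_comm F v]
    simp; ring
  have hinj : Function.Injective R := by
    rw [injective_iff_map_eq_zero]
    intro v hv
    have h1 := hRR v
    rw [hv, map_zero] at h1
    have h2 : ⟪v, v⟫_ℝ + ⟪F, v⟫_ℝ ^ 2 = 0 := by
      have := congrArg (fun z => ⟪z, v⟫_ℝ) h1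
      simp only [inner_zero_left, inner_add_left, inner_smul_left] at this
      simp at this
      rw [real_inner_self_eq_norm_sq]
      linarith [this]
    have h3 : ⟪v, v⟫_ℝ = 0 := by
      nlinarith [real_inner_self_nonneg (x := v), sq_nonneg ⟪F, v⟫_ℝ]
    exact inner_self_eq_zero.1 h3
  set L : V →ₗ[ℝ] V := q • (R ∘ₗ (S : V →ₗ[ℝ] V) ∘ₗ R) with hL
  have hLs : L.IsSymmetric := by
    intro v w
    simp [hL, inner_smul_left, inner_smul_right, hRs, hS]
  set o := hLs.eigenvectorBasis hn with ho
  have hLo : ∀ i, L (o i) = hLs.eigenvalues hn i • o i := fun i =>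
    hLs.apply_eigenvectorBasis hn i
  have hbij : Function.Bijective R := ⟨hinj, LinearMap.injective_iff_surjective.1 hinj⟩
  set b := o.toBasis.map (LinearEquiv.ofBijective R hbij) with hb
  have hbo : ∀ i, b i = R (o i) := fun i => by simp [hb]
  refine ⟨b, hLs.eigenvalues hn, fun i => ?_, fun w => ?_, fun i => ?_⟩
  · have h1 : R (L (o i)) = A (b i) := by
      rw [hA, ← hRR, hbo]
      simp [hL]
    rw [← h1, hLo, map_smul, hbo]
  · simp only [hbo, hRs]
    have := o.sum_repr' (R w)
    rw [← hRR w]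
    conv_lhs => rw [← this]
    rw [map_sum]
    simp
  · have h1 : ⟪L (o i), o i⟫_ℝ = hLs.eigenvalues hn i := by
      rw [hLo, inner_smul_left]
      simp [o.norm_eq_one i]
    rw [← h1, hbo]
    simp [hL, inner_smul_left, hRs]

end Eigenbasis

/-! ### Divergence identities, the second derivative test, and a divergence theorem -/

section Divergence

open scoped InnerProductSpace Topology
open Filter MeasureTheory

variable {V : Type*} [NormedAddCommGroup V] [InnerProductSpace ℝ V]

theorem nonneg_deriv_deriv_of_isLocalMin {f : ℝ → ℝ} {t : ℝ} (h : IsLocalMin f t)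
    (hc : ContinuousAt f t) : 0 ≤ deriv (deriv f) t := by
  by_contra! hneg
  have hmax := isLocalMax_of_deriv_deriv_neg hneg h.deriv_eq_zero hc
  have heq : f =ᶠ[𝓝 t] fun _ => f t := by
    filter_upwards [h, hmax] with y h1 h2 using le_antisymm h2 h1
  have h2 : deriv f =ᶠ[𝓝 t] fun _ => (0 : ℝ) := by
    filter_upwards [heq.eventuallyEq_nhds] with y hy
    rw [hy.deriv_eq, deriv_const]
  rw [h2.deriv_eq, deriv_const] at hneg
  exact lt_irrefl _ hneg

/-- First and second order conditions at a local minimum, in terms of the gradient field. -/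
theorem IsLocalMin.gradient_eq_zero_and_hessian_nonneg {g : V → ℝ} {G : V → V} {x : V}
    {Q : V →L[ℝ] V} (h : IsLocalMin g x) (hG : ∀ᶠ y in 𝓝 x, HasFDerivAt g (innerSL ℝ (G y)) y)
    (hQ : HasFDerivAt G Q x) : G x = 0 ∧ ∀ w, 0 ≤ ⟪w, Q w⟫_ℝ := by
  constructor
  · have h1 := h.hasFDerivAt_eq_zero hG.self_of_nhds
    have h2 := DFunLike.congr_fun h1 (G x)
    simpa using h2
  · intro w
    set c : ℝ → V := fun t => x + t • w with hc
    have hcd : ∀ t, HasDerivAt c w t := fun t => by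
      have h1 := ((hasDerivAt_id t).smul_const w).const_add x
      rw [one_smul] at h1
      exact h1
    have hc0 : c 0 = x := by simp [hc]
    have hct : Tendsto c (𝓝 0) (𝓝 x) := by
      have := (hcd 0).continuousAt.tendsto
      rwa [hc0] at this
    have hmin : IsLocalMin (g ∘ c) 0 := by
      have := hct.eventually h
      simpa [IsLocalMin, IsMinFilter, hc0] using this
    have hd : ∀ᶠ t in 𝓝 (0 : ℝ), HasDerivAt (g ∘ c) ⟪G (c t), w⟫_ℝ t := by
      filter_upwards [hct.eventually hG] with t ht
      simpa using ht.comp_hasDerivAt t (hcd t)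
    have hdd : deriv (g ∘ c) =ᶠ[𝓝 0] fun t => ⟪G (c t), w⟫_ℝ := by
      filter_upwards [hd] with t ht using ht.deriv
    have hd2 : HasDerivAt (fun t => ⟪G (c t), w⟫_ℝ) ⟪Q w, w⟫_ℝ 0 := by
      rw [← hc0] at hQ
      have := (hQ.comp_hasDerivAt 0 (hcd 0)).inner ℝ (hasDerivAt_const (0 : ℝ) w)
      simpa using this
    have := nonneg_deriv_deriv_of_isLocalMin hmin hd.self_of_nhds.continuousAt
    rwa [hdd.deriv_eq, hd2.deriv, real_inner_comm] at this

variable [FiniteDimensional ℝ V]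

/-- The divergence of a vector field, as the trace of its derivative. -/
noncomputable def diver (X : V → V) (x : V) : ℝ := opTrace (fderiv ℝ X x)

theorem diver_smul {f : V → ℝ} {X : V → V} {x : V} (hf : DifferentiableAt ℝ f x)
    (hX : DifferentiableAt ℝ X x) :
    diver (fun y => f y • X y) x = f x * diver X x + fderiv ℝ f x (X x) := by
  rw [diver, fderiv_fun_smul hf hX, map_add, map_smul, smul_eq_mul, opTrace_smulRight, diver]

theorem diver_add {X Y : V → V} {x : V} (hX : DifferentiableAt ℝ X x)
    (hY : DifferentiableAt ℝ Y x) :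
    diver (fun y => X y + Y y) x = diver X x + diver Y x := by
  rw [diver, fderiv_fun_add hX hY, map_add, diver, diver]

theorem diver_sub {X Y : V → V} {x : V} (hX : DifferentiableAt ℝ X x)
    (hY : DifferentiableAt ℝ Y x) :
    diver (fun y => X y - Y y) x = diver X x - diver Y x := by
  rw [diver, fderiv_fun_sub hX hY, map_sub, diver, diver]

theorem diver_id (x : V) : diver (fun y : V => y) x = Module.finrank ℝ V := by
  rw [diver, fderiv_fun_id, ← opTrace_one]
  rfl

theorem diver_congr {X Y : V → V} {x : V} (h : X =ᶠ[𝓝 x] Y) : diver X x = diver Y x := by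
  rw [diver, h.fderiv_eq, diver]

theorem ContDiffAt.newtonTensor_fderiv {F : V → V} {x : V} (hF : ContDiffAt ℝ ∞ F x) (j : ℕ) :
    ContDiffAt ℝ ∞ (fun y => newtonTensor (fderiv ℝ F y) j) x :=
  (contDiff_newtonTensor j).contDiffAt.comp x (hF.fderiv_right (m := ∞) (by simp))

theorem ContDiffAt.opSigma_fderiv {F : V → V} {x : V} (hF : ContDiffAt ℝ ∞ F x) (j : ℕ) :
    ContDiffAt ℝ ∞ (fun y => opSigma (fderiv ℝ F y) j) x :=
  (contDiff_opSigma j).contDiffAt.comp x (hF.fderiv_right (m := ∞) (by simp))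

theorem diver_newtonTensor {F Y : V → V} {x : V} (hF : ContDiffAt ℝ ∞ F x)
    (hY : DifferentiableAt ℝ Y x) (j : ℕ) :
    diver (fun y => newtonTensor (fderiv ℝ F y) j (Y y)) x =
      opTrace (newtonTensor (fderiv ℝ F x) j * fderiv ℝ Y x) := by
  have h1 : HasFDerivAt (fderiv ℝ F) (fderiv ℝ (fderiv ℝ F) x) x :=
    ((hF.fderiv_right (m := ∞) (by simp)).differentiableAt (by simp)).hasFDerivAt
  have h2 := (hasFDerivAt_newtonTensor (fderiv ℝ F x) j).comp x h1
  have h3 := h2.clm_apply hY.hasFDerivAt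
  have h4 : HasFDerivAt (fun y => newtonTensor (fderiv ℝ F y) j (Y y)) _ x := h3
  have hsymm : IsSymmSndFDerivAt ℝ F x := hF.isSymmSndFDerivAt (by
    rw [minSmoothness_of_isRCLikeNormedField]; exact WithTop.coe_le_coe.2 (le_top (a := (2 : ℕ∞))))
  rw [diver, h4.fderiv, map_add]
  rw [opTrace_fderiv_newtonTensor_flip _ _ (fun v w => hsymm v w), add_zero]
  rfl

variable [MeasurableSpace V] [BorelSpace V]

theorem integral_diver_eq_zero {X : V → V} (hX : ContDiff ℝ 1 X) (hc : HasCompactSupport X) :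
    ∫ x, diver X x = 0 := by
  have hcont : Continuous (fderiv ℝ X) := hX.continuous_fderiv (by simp)
  have hint : Integrable (fderiv ℝ X) := hcont.integrable_of_hasCompactSupport (hc.fderiv ℝ)
  have h0 : ∫ x, fderiv ℝ X x = 0 := by
    ext v
    rw [ContinuousLinearMap.integral_apply hint]
    have h := integral_smul_fderiv_eq_neg_fderiv_smul_of_integrable (𝕜 := ℝ) (μ := volume)
      (f := fun _ : V => (1 : ℝ)) (g := X) (v := v) (by simp)
      (by simpa using hint.apply_continuousLinearMap v)
      (by simpa using hX.continuous.integrable_of_hasCompactSupport hc)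
      (fun x _ => by fun_prop) (fun x _ => hX.differentiable (by simp) x)
    simpa using h
  simp only [diver]
  rw [opTrace.integral_comp_comm hint, h0, map_zero]

/-- A divergence theorem for vector fields which vanish at the boundary to the same order as a
positive function `β`; nothing is required of the boundary itself, since the field is cut off
along the level sets of `β`. -/
theorem setIntegral_diver_eq_zero {Ω : Set V} (hΩ : IsOpen Ω) (hb : Bornology.IsBounded Ω)
    {β : V → ℝ} {X : V → V} (hβ : ContDiffOn ℝ 1 β Ω) (hX : ContDiffOn ℝ 1 X Ω)
    (hpos : ∀ x ∈ Ω, 0 < β x) (hcpt : ∀ ε > 0, IsCompact {x ∈ Ω | ε ≤ β x}) {C D : ℝ}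
    (hC : ∀ x ∈ Ω, |fderiv ℝ β x (X x)| ≤ C * β x) (hD : ∀ x ∈ Ω, |diver X x| ≤ D) :
    ∫ x in Ω, diver X x = 0 := by
  classical
  set ψ : ℝ → ℝ := fun s => Real.smoothTransition (s - 1) with hψ
  have hψc : ContDiff ℝ ∞ ψ := by
    have : ContDiff ℝ ∞ Real.smoothTransition := Real.smoothTransition.contDiff
    exact this.comp (contDiff_id.sub contDiff_const)
  have hψ0 : ∀ s ≤ 1, ψ s = 0 := fun s hs => Real.smoothTransition.zero_of_nonpos (by linarith)
  have hψ1 : ∀ s, 2 ≤ s → ψ s = 1 := fun s hs => Real.smoothTransition.one_of_one_le (by linarith)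
  have hψd1 : ∀ s, 2 < s → deriv ψ s = 0 := by
    intro s hs
    have : ψ =ᶠ[𝓝 s] fun _ => (1 : ℝ) := by
      filter_upwards [lt_mem_nhds hs] with y hy using hψ1 y hy.le
    rw [this.deriv_eq, deriv_const]
  obtain ⟨B, hB⟩ : ∃ B, ∀ s, 0 < s → |deriv ψ s * s| ≤ B := by
    have hcont : Continuous fun s => deriv ψ s * s :=
      (hψc.continuous_deriv (by simp)).mul continuous_id
    obtain ⟨B, hB⟩ := (isCompact_Icc (a := (0 : ℝ)) (b := 2)).exists_bound_of_continuousOn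
      hcont.continuousOn
    refine ⟨max B 0, fun s hs => ?_⟩
    rcases le_or_gt s 2 with h | h
    · exact (hB s ⟨hs.le, h⟩).trans (le_max_left _ _)
    · rw [hψd1 s h, zero_mul, abs_zero]; exact le_max_right _ _
  have hβd : ∀ x ∈ Ω, DifferentiableAt ℝ β x := fun x hx =>
    (hβ.contDiffAt (hΩ.mem_nhds hx)).differentiableAt (by simp)
  have hXd : ∀ x ∈ Ω, DifferentiableAt ℝ X x := fun x hx =>
    (hX.contDiffAt (hΩ.mem_nhds hx)).differentiableAt (by simp)
  set Y : ℝ → V → V := fun ε x => ψ (β x / ε) • X x with hY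
  have hYc : ∀ ε x, x ∈ Ω → ContDiffAt ℝ 1 (Y ε) x := by
    intro ε x hx
    have h1 := hβ.contDiffAt (hΩ.mem_nhds hx)
    have h2 := hX.contDiffAt (hΩ.mem_nhds hx)
    exact (((hψc.of_le (by simp)).contDiffAt).comp x (h1.div_const ε)).smul h2
  have hYdiv : ∀ ε x, x ∈ Ω → diver (Y ε) x =
      ψ (β x / ε) * diver X x + deriv ψ (β x / ε) * (fderiv ℝ β x (X x) / ε) := by
    intro ε x hx
    have h1 : HasFDerivAt (fun y => β y / ε) (ε⁻¹ • fderiv ℝ β x) x := by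
      simpa only [div_eq_inv_mul, smul_eq_mul] using (hβd x hx).hasFDerivAt.const_mul ε⁻¹
    have h2 : HasFDerivAt (fun y => ψ (β y / ε)) (deriv ψ (β x / ε) • ε⁻¹ • fderiv ℝ β x) x :=
      ((hψc.differentiable (by simp)) _).hasDerivAt.comp_hasFDerivAt x h1
    rw [hY, diver_smul h2.differentiableAt (hXd x hx), h2.fderiv]
    simp only [smul_apply, smul_eq_mul]
    ring
  have hzero : ∀ ε > 0, ∫ x in Ω, diver (Y ε) x = 0 := by
    intro ε hε
    set Z : V → V := Ω.indicator (Y ε) with hZ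
    set K : Set V := {x ∈ Ω | ε ≤ β x} with hK
    have hZ0 : ∀ x ∉ K, Z x = 0 := by
      intro x hx
      by_cases hxΩ : x ∈ Ω
      · have : β x < ε := by
          by_contra! h
          exact hx ⟨hxΩ, h⟩
        rw [hZ, Set.indicator_of_mem hxΩ, hY]
        simp only
        rw [hψ0 _ ((div_le_one hε).2 this.le), zero_smul]
      · exact Set.indicator_of_notMem hxΩ _
    have hKc : IsCompact K := hcpt ε hε
    have hZe : ∀ x ∈ Ω, Z =ᶠ[𝓝 x] Y ε := by
      intro x hx
      filter_upwards [hΩ.mem_nhds hx] with y hy using Set.indicator_of_mem hy _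
    have hZe0 : ∀ x ∉ Ω, Z =ᶠ[𝓝 x] fun _ => 0 := by
      intro x hx
      have : x ∉ K := fun h => hx h.1
      filter_upwards [hKc.isClosed.isOpen_compl.mem_nhds this] with y hy using hZ0 y hy
    have hZc : ContDiff ℝ 1 Z := by
      rw [contDiff_iff_contDiffAt]
      intro x
      by_cases hx : x ∈ Ω
      · exact (hYc ε x hx).congr_of_eventuallyEq (hZe x hx)
      · exact contDiffAt_const.congr_of_eventuallyEq (hZe0 x hx)
    have hZs : HasCompactSupport Z := HasCompactSupport.intro hKc hZ0
    have h0 := integral_diver_eq_zero hZc hZs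
    rw [← setIntegral_eq_integral_of_forall_compl_eq_zero (s := Ω)] at h0
    · rw [← h0]
      exact setIntegral_congr_fun hΩ.measurableSet fun x hx => (diver_congr (hZe x hx)).symm
    · intro x hx
      rw [diver_congr (hZe0 x hx), diver]
      simp
  have hlim : Tendsto (fun m : ℕ => ∫ x in Ω, diver (Y (1 / (m + 1))) x) atTop
      (𝓝 (∫ x in Ω, diver X x)) := by
    have hfin : volume Ω < ⊤ := hb.measure_lt_top
    have hC0 : ∀ x ∈ Ω, 0 ≤ C := by
      intro x hx
      have := (abs_nonneg _).trans (hC x hx)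
      exact nonneg_of_mul_nonneg_left this (hpos x hx)
    refine tendsto_integral_of_dominated_convergence (fun _ => D + B * C) ?_ ?_ ?_ ?_
    · intro m
      have : ContinuousOn (fun x => diver (Y (1 / ((m : ℝ) + 1))) x) Ω := by
        refine opTrace.continuous.comp_continuousOn ?_
        have h : ContDiffOn ℝ 1 (Y (1 / ((m : ℝ) + 1))) Ω := fun x hx =>
          (hYc _ x hx).contDiffWithinAt
        exact h.continuousOn_fderiv_of_isOpen hΩ (by simp)
      exact this.aestronglyMeasurable hΩ.measurableSet
    · exact integrableOn_const hfin.ne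
    · intro m
      refine (ae_restrict_iff' hΩ.measurableSet).2 (ae_of_all _ fun x hx => ?_)
      have hε : (0 : ℝ) < 1 / (m + 1) := by positivity
      have hs : 0 < β x / (1 / ((m : ℝ) + 1)) := div_pos (hpos x hx) hε
      rw [hYdiv _ x hx, Real.norm_eq_abs]
      refine (abs_add_le _ _).trans (add_le_add ?_ ?_)
      · rw [abs_mul, abs_of_nonneg (Real.smoothTransition.nonneg _)]
        calc _ ≤ 1 * |diver X x| := by
              gcongr
              exact Real.smoothTransition.le_one _
          _ ≤ D := by rw [one_mul]; exact hD x hx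
      · have h1 : |fderiv ℝ β x (X x) / (1 / ((m : ℝ) + 1))| ≤
            C * (β x / (1 / ((m : ℝ) + 1))) := by
          rw [abs_div, abs_of_pos hε, ← mul_div_assoc]
          gcongr
          exact hC x hx
        rw [abs_mul]
        have h2 := hB _ hs
        rw [abs_mul, abs_of_pos hs] at h2
        calc _ ≤ |deriv ψ (β x / (1 / ((m : ℝ) + 1)))| * (C * (β x / (1 / ((m : ℝ) + 1)))) := by
              gcongr
          _ = (|deriv ψ (β x / (1 / ((m : ℝ) + 1)))| * (β x / (1 / ((m : ℝ) + 1)))) * C := by ring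
          _ ≤ B * C := mul_le_mul_of_nonneg_right h2 (hC0 x hx)
    · refine (ae_restrict_iff' hΩ.measurableSet).2 (ae_of_all _ fun x hx => ?_)
      refine tendsto_const_nhds.congr' ?_
      obtain ⟨m0, hm0⟩ := exists_nat_gt (2 / β x)
      filter_upwards [eventually_ge_atTop m0] with m hm
      have hβx := hpos x hx
      have hs : 2 < β x / (1 / ((m : ℝ) + 1)) := by
        rw [div_div_eq_mul_div, div_one]
        have : (m0 : ℝ) ≤ m := by exact_mod_cast hm
        rw [div_lt_iff₀ hβx] at hm0
        nlinarith
      rw [hYdiv _ x hx, hψ1 _ hs.le, hψd1 _ hs]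
      ring
  have hz : (fun m : ℕ => ∫ x in Ω, diver (Y (1 / ((m : ℝ) + 1))) x) = fun _ => 0 := by
    funext m
    exact hzero _ (by positivity)
  rw [hz] at hlim
  exact tendsto_nhds_unique hlim tendsto_const_nhds

end Divergence

/-! ### Pointwise geometry of a spacelike graph -/

section Graph

open scoped InnerProductSpace Topology
open Filter

variable {V : Type*} [NormedAddCommGroup V] [InnerProductSpace ℝ V]

/-- The data of a spacelike graph `x ↦ x + u(x) N₀` over the open set `Ω`, with unit normal
`q N₀ + F`. The gradient of `u` is `F / q`, and the derivative of `F` is the shape operator. -/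
structure IsGraphData (Ω : Set V) (u : V → ℝ) (F : V → V) (q : V → ℝ) : Prop where
  isOpen : IsOpen Ω
  contDiffOn : ContDiffOn ℝ ∞ F Ω
  q_eq : ∀ x ∈ Ω, q x = √(1 + ‖F x‖ ^ 2)
  hasFDerivAt : ∀ x ∈ Ω, HasFDerivAt u (innerSL ℝ ((q x)⁻¹ • F x)) x

namespace IsGraphData

variable {Ω : Set V} {u : V → ℝ} {F : V → V} {q : V → ℝ}

theorem contDiffAt (hg : IsGraphData Ω u F q) {x : V} (hx : x ∈ Ω) : ContDiffAt ℝ ∞ F x :=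
  hg.contDiffOn.contDiffAt (hg.isOpen.mem_nhds hx)

theorem q_sq (hg : IsGraphData Ω u F q) {x : V} (hx : x ∈ Ω) : q x ^ 2 = 1 + ‖F x‖ ^ 2 := by
  rw [hg.q_eq x hx, Real.sq_sqrt (by positivity)]

theorem q_pos (hg : IsGraphData Ω u F q) {x : V} (hx : x ∈ Ω) : 0 < q x := by
  rw [hg.q_eq x hx]; positivity

theorem one_le_q (hg : IsGraphData Ω u F q) {x : V} (hx : x ∈ Ω) : 1 ≤ q x := by
  rw [hg.q_eq x hx, Real.one_le_sqrt]
  nlinarith [sq_nonneg ‖F x‖]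

theorem contDiffAt_q (hg : IsGraphData Ω u F q) {x : V} (hx : x ∈ Ω) : ContDiffAt ℝ ∞ q x := by
  have h1 : ContDiffAt ℝ ∞ (fun y => √(1 + ‖F y‖ ^ 2)) x :=
    (contDiffAt_const.add ((hg.contDiffAt hx).norm_sq ℝ)).sqrt (by positivity)
  refine h1.congr_of_eventuallyEq ?_
  filter_upwards [hg.isOpen.mem_nhds hx] with y hy using hg.q_eq y hy

theorem contDiffAt_gradient (hg : IsGraphData Ω u F q) {x : V} (hx : x ∈ Ω) :
    ContDiffAt ℝ ∞ (fun y => (q y)⁻¹ • F y) x :=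
  ((hg.contDiffAt_q hx).inv (hg.q_pos hx).ne').smul (hg.contDiffAt hx)

theorem contDiffAt_u (hg : IsGraphData Ω u F q) {x : V} (hx : x ∈ Ω) : ContDiffAt ℝ 1 u x := by
  rw [contDiffAt_one_iff]
  refine ⟨fun y => innerSL ℝ ((q y)⁻¹ • F y), Ω, hg.isOpen.mem_nhds hx, ?_, hg.hasFDerivAt⟩
  intro y hy
  exact ((innerSL ℝ (E := V)).continuous.continuousAt.comp
    (hg.contDiffAt_gradient hy).continuousAt).continuousWithinAt

theorem fderiv_q (hg : IsGraphData Ω u F q) {x : V} (hx : x ∈ Ω) (v : V) :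
    fderiv ℝ q x v = ⟪(q x)⁻¹ • F x, fderiv ℝ F x v⟫_ℝ := by
  have hF := ((hg.contDiffAt hx).differentiableAt (by simp)).hasFDerivAt
  have h1 : HasFDerivAt (fun y => 1 + ‖F y‖ ^ 2) _ x := hF.norm_sq.const_add 1
  have h2 := h1.sqrt (by positivity)
  have h3 : q =ᶠ[𝓝 x] fun y => √(1 + ‖F y‖ ^ 2) := by
    filter_upwards [hg.isOpen.mem_nhds hx] with y hy using hg.q_eq y hy
  have hq := hg.q_pos hx
  rw [h3.fderiv_eq, h2.fderiv, ← hg.q_eq x hx]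
  simp [inner_smul_left]
  field_simp

theorem inner_hessian_comm (hg : IsGraphData Ω u F q) {x : V} (hx : x ∈ Ω) (v w : V) :
    ⟪fderiv ℝ (fun y => (q y)⁻¹ • F y) x v, w⟫_ℝ =
      ⟪v, fderiv ℝ (fun y => (q y)⁻¹ • F y) x w⟫_ℝ := by
  have hG := ((hg.contDiffAt_gradient hx).differentiableAt (by simp)).hasFDerivAt
  have h1 : HasFDerivAt (fun y => innerSL ℝ ((q y)⁻¹ • F y)) _ x :=
    (innerSL ℝ (E := V)).hasFDerivAt.comp x hG
  have h2 : ∀ᶠ y in 𝓝 x, HasFDerivAt u (innerSL ℝ ((q y)⁻¹ • F y)) y := by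
    filter_upwards [hg.isOpen.mem_nhds hx] with y hy using hg.hasFDerivAt y hy
  have h3 := second_derivative_symmetric_of_eventually_of_real h2 h1 v w
  rw [real_inner_comm _ v]
  exact h3

/-- The shape operator in terms of the Hessian `S` of `u`: `A = q (1 + F ⊗ F) S`. -/
theorem fderiv_eq_hessian (hg : IsGraphData Ω u F q) {x : V} (hx : x ∈ Ω) (v : V) :
    fderiv ℝ F x v = q x • (fderiv ℝ (fun y => (q y)⁻¹ • F y) x v +
      ⟪F x, fderiv ℝ (fun y => (q y)⁻¹ • F y) x v⟫_ℝ • F x) := by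
  have hG := ((hg.contDiffAt_gradient hx).differentiableAt (by simp)).hasFDerivAt
  have hq := ((hg.contDiffAt_q hx).differentiableAt (by simp)).hasFDerivAt
  have h1 : HasFDerivAt (fun y => q y • ((q y)⁻¹ • F y)) _ x := hq.smul hG
  have h2 : F =ᶠ[𝓝 x] fun y => q y • ((q y)⁻¹ • F y) := by
    filter_upwards [hg.isOpen.mem_nhds hx] with y hy
    rw [smul_inv_smul₀ (hg.q_pos hy).ne']
  have h3 := (h1.congr_of_eventuallyEq h2).fderiv
  set S := fderiv ℝ (fun y => (q y)⁻¹ • F y) x with hS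
  have h4 : fderiv ℝ F x v = q x • S v + fderiv ℝ q x v • ((q x)⁻¹ • F x) := by
    conv_lhs => rw [h3]
    simp
  have hqx := hg.q_pos hx
  have hsq := hg.q_sq hx
  have h5 : fderiv ℝ q x v = q x ^ 2 * ⟪F x, S v⟫_ℝ := by
    have e := hg.fderiv_q hx v
    rw [h4] at e
    simp only [inner_add_right, inner_smul_left, inner_smul_right, real_inner_self_eq_norm_sq] at e
    simp only [conj_trivial] at e
    have hF2 : ‖F x‖ ^ 2 = q x ^ 2 - 1 := by linarith
    rw [hF2] at e
    field_simp at e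
    linarith
  rw [h4, h5, smul_smul, smul_add, smul_smul]
  congr 2
  field_simp

variable [FiniteDimensional ℝ V]

/-- The gradient of `q` is `Aᵀ ∇u`. -/
theorem hasFDerivAt_q (hg : IsGraphData Ω u F q) {x : V} (hx : x ∈ Ω) :
    HasFDerivAt q (innerSL ℝ ((fderiv ℝ F x).adjoint ((q x)⁻¹ • F x))) x := by
  have h1 := ((hg.contDiffAt_q hx).differentiableAt (by simp)).hasFDerivAt
  have h2 : innerSL ℝ ((fderiv ℝ F x).adjoint ((q x)⁻¹ • F x)) = fderiv ℝ q x := by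
    ext v
    rw [hg.fderiv_q hx, innerSL_apply_apply, ContinuousLinearMap.adjoint_inner_left]
  rw [h2]
  exact h1

theorem exists_eigenbasis (hg : IsGraphData Ω u F q) {n : ℕ} (hn : Module.finrank ℝ V = n) {x : V}
    (hx : x ∈ Ω) :
    ∃ (b : Module.Basis (Fin n) ℝ V) (l : Fin n → ℝ), (∀ i, fderiv ℝ F x (b i) = l i • b i) ∧
      (∀ w, w + ⟪F x, w⟫_ℝ • F x = ∑ i, ⟪b i, w⟫_ℝ • b i) ∧
      ∀ i, l i = q x * ⟪fderiv ℝ (fun y => (q y)⁻¹ • F y) x (b i), b i⟫_ℝ :=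
  exists_eigenbasis_graph hn (hg.q_pos hx) (hg.q_sq hx) (hg.inner_hessian_comm hx)
    (hg.fderiv_eq_hessian hx)

/-- With `M = 1 + F ⊗ F` the operators `M Aᵀ` and `A M` agree, so that
`M (c ∇u - ∇q) = q (c F - A F)`. -/
theorem metric_gradient (hg : IsGraphData Ω u F q) {x : V} (hx : x ∈ Ω) (c : ℝ) :
    (1 + (innerSL ℝ (F x)).smulRight (F x) : V →L[ℝ] V)
      (c • ((q x)⁻¹ • F x) - (fderiv ℝ F x).adjoint ((q x)⁻¹ • F x)) =
      q x • (c • F x - fderiv ℝ F x (F x)) := by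
  set M : V →L[ℝ] V := 1 + (innerSL ℝ (F x)).smulRight (F x) with hM
  set A := fderiv ℝ F x with hA
  set S := fderiv ℝ (fun y => (q y)⁻¹ • F y) x with hS
  have hqx := hg.q_pos hx
  have hMa : ∀ w, M w = w + ⟪F x, w⟫_ℝ • F x := fun w => by simp [hM]
  have hMs : ∀ v w, ⟪M v, w⟫_ℝ = ⟪v, M w⟫_ℝ := by
    intro v w
    simp only [hMa, inner_add_left, inner_add_right, inner_smul_left, inner_smul_right,
      real_inner_comm (F x) v, conj_trivial]
    ring
  have hAM : ∀ v, A v = q x • M (S v) := fun v => by rw [hMa]; exact hg.fderiv_eq_hessian hx v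
  have hSs : ∀ v w, ⟪S v, w⟫_ℝ = ⟪v, S w⟫_ℝ := hg.inner_hessian_comm hx
  have hMG : M ((q x)⁻¹ • F x) = q x • F x := by
    have h1 : F x + ‖F x‖ ^ 2 • F x = (1 + ‖F x‖ ^ 2) • F x := by rw [add_smul, one_smul]
    rw [map_smul, hMa, real_inner_self_eq_norm_sq, h1, ← hg.q_sq hx, smul_smul]
    congr 1
    field_simp
  have hMA : M (A.adjoint ((q x)⁻¹ • F x)) = q x • A (F x) := by
    refine ext_inner_right ℝ fun w => ?_
    rw [hMs, ContinuousLinearMap.adjoint_inner_left, hAM (M w), inner_smul_right, ← hMs, hMG,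
      ← hSs, ← hMs, hAM (F x)]
    simp only [map_smul, inner_smul_left, conj_trivial]
  rw [map_sub, map_smul, hMG, hMA, smul_sub, smul_comm]

/-- The divergence of `T_j (c F - A F)` when `σ_{j+1}` is constant. -/
theorem diver_newtonTensor_sub (hg : IsGraphData Ω u F q) {j : ℕ} {K : ℝ}
    (hK : ∀ x ∈ Ω, opSigma (fderiv ℝ F x) (j + 1) = K) {x : V} (hx : x ∈ Ω) (c : ℝ) :
    diver (fun y => newtonTensor (fderiv ℝ F y) j (c • F y - fderiv ℝ F y (F y))) x =
      c * ((j + 1) * K) - (opSigma (fderiv ℝ F x) 1 * K -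
        (j + 1 + 1) * opSigma (fderiv ℝ F x) (j + 2)) := by
  have hF := hg.contDiffAt hx
  have hFd := hF.differentiableAt (by simp : (∞ : WithTop ℕ∞) ≠ 0)
  have e : (fun y => newtonTensor (fderiv ℝ F y) j (c • F y - fderiv ℝ F y (F y))) =ᶠ[𝓝 x]
      fun y => (newtonTensor (fderiv ℝ F y) j (c • F y) - K • F y) +
        newtonTensor (fderiv ℝ F y) (j + 1) (F y) := by
    filter_upwards [hg.isOpen.mem_nhds hx] with y hy
    rw [newtonTensor_succ, hK y hy, map_sub]
    simp
  have d1 : ∀ j, DifferentiableAt ℝ (fun y => newtonTensor (fderiv ℝ F y) j) x := fun j =>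
    (hF.newtonTensor_fderiv j).differentiableAt (by simp)
  have t1 : opTrace (fderiv ℝ F x) = opSigma (fderiv ℝ F x) 1 := by
    have := opTrace_newtonTensor_mul (fderiv ℝ F x) 0
    rw [newtonTensor_zero, one_mul] at this
    simpa using this
  have dcF : DifferentiableAt ℝ (fun y => c • F y) x := hFd.const_smul c
  have dKF : DifferentiableAt ℝ (fun y => K • F y) x := hFd.const_smul K
  have d2 : DifferentiableAt ℝ
      (fun y => newtonTensor (fderiv ℝ F y) j (c • F y) - K • F y) x :=
    ((d1 j).clm_apply dcF).sub dKF
  rw [diver_congr e, diver_add d2 ((d1 (j + 1)).clm_apply hFd),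
    diver_sub ((d1 j).clm_apply dcF) dKF, diver_newtonTensor hF dcF, diver_newtonTensor hF hFd,
    fderiv_fun_const_smul hFd, opTrace_newtonTensor_mul, mul_smul_comm, map_smul,
    opTrace_newtonTensor_mul, hK x hx, diver, fderiv_fun_const_smul hFd, map_smul, t1]
  push_cast
  simp only [smul_eq_mul]
  ring

/-- The second order condition at a minimum of `c u - q`, read through the elliptic operator
with coefficients `T_j`. -/
theorem nonneg_of_isLocalMin (hg : IsGraphData Ω u F q) {n : ℕ} (hn : Module.finrank ℝ V = n)
    {j : ℕ} {K : ℝ}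
    (hK : ∀ x ∈ Ω, opSigma (fderiv ℝ F x) (j + 1) = K) {x : V} (hx : x ∈ Ω)
    (hpos : ∀ i ≤ j + 1, 0 < opSigma (fderiv ℝ F x) i) {c : ℝ}
    (hmin : IsLocalMin (fun y => c * u y - q y) x) :
    0 ≤ c * ((j + 1) * K) - (opSigma (fderiv ℝ F x) 1 * K -
        (j + 1 + 1) * opSigma (fderiv ℝ F x) (j + 2)) := by
  set G : V → V := fun y =>
    c • ((q y)⁻¹ • F y) - (fderiv ℝ F y).adjoint ((q y)⁻¹ • F y) with hG
  have hF := hg.contDiffAt hx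
  have hGd : ∀ᶠ y in 𝓝 x, HasFDerivAt (fun y => c * u y - q y) (innerSL ℝ (G y)) y := by
    filter_upwards [hg.isOpen.mem_nhds hx] with y hy
    have := ((hg.hasFDerivAt y hy).const_mul c).sub (hg.hasFDerivAt_q hy)
    rw [hG, map_sub, map_smul]
    exact this
  have hGc : ContDiffAt ℝ ∞ G x := by
    have h1 := hg.contDiffAt_gradient hx
    have h2 : ContDiffAt ℝ ∞ (fun y => (fderiv ℝ F y).adjoint) x :=
      (ContinuousLinearMap.adjoint (𝕜 := ℝ) (E := V) (F := V)).toContinuousLinearEquiv.contDiff.contDiffAt.comp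
        x (hF.fderiv_right (m := ∞) (by simp))
    exact (contDiffAt_const.smul h1).sub (h2.clm_apply h1)
  have hQ := (hGc.differentiableAt (by simp)).hasFDerivAt
  obtain ⟨hG0, hQ0⟩ := hmin.gradient_eq_zero_and_hessian_nonneg hGd hQ
  set Q := fderiv ℝ G x with hQdef
  obtain ⟨b, l, hb, hM, -⟩ := hg.exists_eigenbasis hn hx
  set M : V → V →L[ℝ] V := fun y => 1 + (innerSL ℝ (F y)).smulRight (F y) with hMdef
  have hMc : ContDiffAt ℝ ∞ M x :=
    contDiffAt_const.add (((innerSL ℝ (E := V)).contDiff.contDiffAt.comp x hF).smulRight hF)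
  set Kx : V → V →L[ℝ] V := fun y => (q y)⁻¹ • (newtonTensor (fderiv ℝ F y) j * M y) with hKx
  have hKc : ContDiffAt ℝ ∞ Kx x :=
    ((hg.contDiffAt_q hx).inv (hg.q_pos hx).ne').smul ((hF.newtonTensor_fderiv j).mul hMc)
  have e : (fun y => newtonTensor (fderiv ℝ F y) j (c • F y - fderiv ℝ F y (F y))) =ᶠ[𝓝 x]
      fun y => Kx y (G y) := by
    filter_upwards [hg.isOpen.mem_nhds hx] with y hy
    have h1 := hg.metric_gradient hy c
    simp only [hKx, smul_apply, mul_apply_eq_comp]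
    rw [hMdef, hG]
    simp only
    rw [h1, map_smul, inv_smul_smul₀ (hg.q_pos hy).ne']
  have hder : HasFDerivAt (fun y => Kx y (G y)) (Kx x * Q) x := by
    have := (hKc.differentiableAt (by simp)).hasFDerivAt.clm_apply hQ
    rw [hG0] at this
    convert this using 1
    ext v
    simp
  rw [← hg.diver_newtonTensor_sub hK hx c, diver_congr e, diver, hder.fderiv, hKx]
  simp only
  rw [smul_mul_assoc, map_smul, smul_eq_mul,
    opTrace_eq_sum_inner b (newtonTensor_of_eigenbasis b hb j) (fun w => by rw [← hM w]; simp [hMdef])]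
  refine mul_nonneg (inv_nonneg.2 (hg.q_pos hx).le) (Finset.sum_nonneg fun i _ => ?_)
  refine mul_nonneg ?_ (hQ0 _)
  refine (Multiset.esymm_pos_of_cons (a := l i) (k := j) ?_ j le_rfl).le
  intro m hm
  have := hpos m hm
  rw [opSigma_of_eigenbasis b hb, ← Finset.insert_erase (Finset.mem_univ i),
    Finset.insert_val_of_notMem (Finset.notMem_erase i _), Multiset.map_cons] at this
  simpa using this

end IsGraphData

end Graph

/-! ### Graphs of constant `σ_k` meeting a hyperplane at a constant angle -/

section CappedGraph

open scoped InnerProductSpace Topology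
open Filter MeasureTheory

variable {V : Type*} [NormedAddCommGroup V] [InnerProductSpace ℝ V] [FiniteDimensional ℝ V]

/-- A spacelike graph over a bounded domain, with `σ_k` of its shape operator equal to `K`, whose
boundary lies in the hyperplane `u = 0` and meets it at a constant angle (`q = q₀`). -/
structure IsCappedGraph (Ω : Set V) (u : V → ℝ) (F : V → V) (q : V → ℝ) (k : ℕ) (K q₀ : ℝ) : Prop
    extends IsGraphData Ω u F q where
  isConnected : IsConnected Ω
  isBounded : Bornology.IsBounded Ω
  continuousOn_u : ContinuousOn u (closure Ω)
  continuousOn_q : ContinuousOn q (closure Ω)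
  u_frontier : ∀ x ∈ frontier Ω, u x = 0
  q_frontier : ∀ x ∈ frontier Ω, q x = q₀
  sigma_eq : ∀ x ∈ Ω, opSigma (fderiv ℝ F x) k = K
  exists_bound : ∃ C, ∀ x ∈ Ω, ‖fderiv ℝ F x‖ ≤ C

namespace IsCappedGraph

variable {Ω : Set V} {u : V → ℝ} {F : V → V} {q : V → ℝ} {k : ℕ} {K q₀ : ℝ}

theorem isCompact_closure (hg : IsCappedGraph Ω u F q k K q₀) : IsCompact (closure Ω) :=
  hg.isBounded.isCompact_closure

theorem mem_or_mem_frontier (hg : IsCappedGraph Ω u F q k K q₀) {x : V} (hx : x ∈ closure Ω) :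
    x ∈ Ω ∨ x ∈ frontier Ω := by
  by_cases h : x ∈ Ω
  · exact Or.inl h
  · refine Or.inr ⟨hx, ?_⟩
    rwa [hg.isOpen.interior_eq]

theorem continuousOn_opSigma (hg : IsCappedGraph Ω u F q k K q₀) (j : ℕ) :
    ContinuousOn (fun x => opSigma (fderiv ℝ F x) j) Ω := fun _ hx =>
  ((hg.contDiffAt hx).opSigma_fderiv j).continuousAt.continuousWithinAt

theorem isLocalMin_of_isMinOn (hg : IsCappedGraph Ω u F q k K q₀) {f : V → ℝ} {x : V} (hx : x ∈ Ω)
    (h : IsMinOn f (closure Ω) x) : IsLocalMin f x :=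
  h.isLocalMin (mem_of_superset (hg.isOpen.mem_nhds hx) subset_closure)

/-- If `u` is negative somewhere, a paraboloid touches the graph from below at a point where the
Hessian, and hence the shape operator, is positive definite. -/
theorem exists_sigma_pos (hg : IsCappedGraph Ω u F q k K q₀) {x₀ : V} (hx₀ : x₀ ∈ Ω)
    (hu : u x₀ < 0) : ∃ x ∈ Ω, ∀ j ≤ Module.finrank ℝ V, 0 < opSigma (fderiv ℝ F x) j := by
  obtain ⟨R, hR⟩ := hg.isCompact_closure.isBounded.exists_norm_le
  set D : ℝ := (R + ‖x₀‖) ^ 2 + 1 with hD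
  have hDpos : 0 < D := by positivity
  have hDle : ∀ x ∈ closure Ω, ‖x - x₀‖ ^ 2 < D := by
    intro x hx
    have h1 : ‖x - x₀‖ ≤ R + ‖x₀‖ := (norm_sub_le _ _).trans (by gcongr; exact hR x hx)
    have : ‖x - x₀‖ ^ 2 ≤ (R + ‖x₀‖) ^ 2 := by gcongr
    linarith
  set δ : ℝ := -u x₀ / D with hδ
  have hδpos : 0 < δ := div_pos (by linarith) hDpos
  have hcont : ContinuousOn (fun x => u x - δ * ‖x - x₀‖ ^ 2) (closure Ω) :=
    hg.continuousOn_u.sub (by fun_prop)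
  obtain ⟨x, hx, hmin⟩ := hg.isCompact_closure.exists_isMinOn
    ⟨x₀, subset_closure hx₀⟩ hcont
  have hle : u x - δ * ‖x - x₀‖ ^ 2 ≤ u x₀ := by
    have := hmin (subset_closure hx₀)
    simpa using this
  have hxΩ : x ∈ Ω := by
    rcases hg.mem_or_mem_frontier hx with h | h
    · exact h
    · exfalso
      rw [hg.u_frontier x h] at hle
      have : δ * ‖x - x₀‖ ^ 2 < δ * D := by gcongr; exact hDle x hx
      have e : δ * D = -u x₀ := by rw [hδ]; field_simp
      linarith
  refine ⟨x, hxΩ, ?_⟩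
  have hgrad : ∀ᶠ y in 𝓝 x, HasFDerivAt (fun x => u x - δ * ‖x - x₀‖ ^ 2)
      (innerSL ℝ ((q y)⁻¹ • F y - (2 * δ) • (y - x₀))) y := by
    filter_upwards [hg.isOpen.mem_nhds hxΩ] with y hy
    have h1 : HasFDerivAt (fun x : V => x - x₀) (ContinuousLinearMap.id ℝ V) y :=
      (hasFDerivAt_id y).sub_const x₀
    have h2 := (hg.hasFDerivAt y hy).sub ((h1.norm_sq).const_mul δ)
    refine h2.congr_fderiv ?_
    ext v
    simp
    ring
  have hG := ((hg.contDiffAt_gradient hxΩ).differentiableAt (by simp)).hasFDerivAt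
  have hQ : HasFDerivAt (fun y => (q y)⁻¹ • F y - (2 * δ) • (y - x₀))
      (fderiv ℝ (fun y => (q y)⁻¹ • F y) x - (2 * δ) • ContinuousLinearMap.id ℝ V) x :=
    hG.sub (((hasFDerivAt_id x).sub_const x₀).const_smul (2 * δ))
  obtain ⟨-, hpsd⟩ :=
    (hg.isLocalMin_of_isMinOn hxΩ hmin).gradient_eq_zero_and_hessian_nonneg hgrad hQ
  obtain ⟨b, l, hb, -, hl⟩ := hg.exists_eigenbasis rfl hxΩ
  have hlpos : ∀ i, 0 < l i := by
    intro i
    rw [hl i]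
    refine mul_pos (hg.q_pos hxΩ) ?_
    have h1 := hpsd (b i)
    simp only [sub_apply, smul_apply, inner_sub_right, inner_smul_right,
      ContinuousLinearMap.id_apply, real_inner_self_eq_norm_sq] at h1
    rw [real_inner_comm]
    have h2 : 0 < ‖b i‖ := norm_pos_iff.2 (b.ne_zero i)
    have : 0 < 2 * δ * ‖b i‖ ^ 2 := by positivity
    linarith
  intro j hj
  rw [opSigma_of_eigenbasis b hb]
  refine Multiset.esymm_pos ?_ (by simpa using hj)
  intro a ha
  obtain ⟨i, -, rfl⟩ := Multiset.mem_map.1 ha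
  exact hlpos i

/-- The shape operator stays in the Gårding cone: by Maclaurin's inequality the cone is relatively
closed where `σ_k` is a positive constant. -/
theorem sigma_pos (hg : IsCappedGraph Ω u F q k K q₀) (hk : k ≤ Module.finrank ℝ V) {h : ℝ}
    (hh : 0 < h) (hK : K = (Module.finrank ℝ V).choose k * h ^ k)
    (hex : ∃ x ∈ Ω, ∀ j ≤ k, 0 < opSigma (fderiv ℝ F x) j) :
    ∀ x ∈ Ω, ∀ j ≤ k, 0 < opSigma (fderiv ℝ F x) j := by
  set U : Set V := {x ∈ Ω | ∀ j ≤ k, 0 < opSigma (fderiv ℝ F x) j} with hU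
  have hUopen : IsOpen U := by
    rw [isOpen_iff_mem_nhds]
    rintro x ⟨hx, hpos⟩
    have h1 : ∀ᶠ y in 𝓝 x, ∀ j ∈ Finset.range (k + 1), 0 < opSigma (fderiv ℝ F y) j := by
      rw [Filter.eventually_all_finset]
      intro j hj
      exact ((hg.continuousOn_opSigma j).continuousAt (hg.isOpen.mem_nhds hx)).eventually
        (lt_mem_nhds (hpos j (by simpa [Nat.lt_succ_iff] using hj)))
    filter_upwards [hg.isOpen.mem_nhds hx, h1] with y hy hy'
    exact ⟨hy, fun j hj => hy' j (by simpa [Nat.lt_succ_iff] using hj)⟩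
  have hsub : Ω ⊆ U := by
    refine hg.isConnected.isPreconnected.subset_of_closure_inter_subset hUopen ?_ ?_
    · obtain ⟨x, hx, hpos⟩ := hex
      exact ⟨x, hx, hx, hpos⟩
    · rintro x ⟨hxU, hx⟩
      refine ⟨hx, fun j hj => ?_⟩
      have hc : (0 : ℝ) < (Module.finrank ℝ V).choose j := by
        exact_mod_cast Nat.choose_pos (hj.trans hk)
      suffices (Module.finrank ℝ V).choose j * h ^ j ≤ opSigma (fderiv ℝ F x) j from
        lt_of_lt_of_le (by positivity) this
      have : (𝓝[U] x).NeBot := mem_closure_iff_nhdsWithin_neBot.1 hxU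
      have hlim : Tendsto (fun y => opSigma (fderiv ℝ F y) j) (𝓝[U] x)
          (𝓝 (opSigma (fderiv ℝ F x) j)) :=
        ((hg.continuousOn_opSigma j).continuousAt (hg.isOpen.mem_nhds hx)).tendsto.mono_left
          nhdsWithin_le_nhds
      refine ge_of_tendsto hlim ?_
      filter_upwards [self_mem_nhdsWithin] with y hy
      obtain ⟨b, l, hb, -, -⟩ := hg.exists_eigenbasis rfl hy.1
      have hcard : (Finset.univ.val.map l).card = Module.finrank ℝ V := by simp
      have h1 := Multiset.maclaurin (s := Finset.univ.val.map l) (k := k) (by rwa [hcard])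
        (fun i hi => by rw [← opSigma_of_eigenbasis b hb]; exact hy.2 i hi) hh
        (by rw [hcard, ← opSigma_of_eigenbasis b hb, hg.sigma_eq y hy.1, hK]) hj
      rwa [hcard, ← opSigma_of_eigenbasis b hb] at h1
  exact fun x hx => (hsub hx).2

/-- As `σ_1 > 0`, the function `u` has no interior maximum. -/
theorem u_neg (hg : IsCappedGraph Ω u F q k K q₀)
    (hpos : ∀ x ∈ Ω, 0 < opSigma (fderiv ℝ F x) 1) : ∀ x ∈ Ω, u x < 0 := by
  have hno : ∀ x ∈ Ω, ¬ IsMinOn (fun y => -u y) (closure Ω) x := by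
    intro x hx hmin
    have hgrad : ∀ᶠ y in 𝓝 x, HasFDerivAt (fun y => -u y)
        (innerSL ℝ (-((q y)⁻¹ • F y))) y := by
      filter_upwards [hg.isOpen.mem_nhds hx] with y hy
      rw [map_neg]
      exact (hg.hasFDerivAt y hy).neg
    have hG := ((hg.contDiffAt_gradient hx).differentiableAt (by simp)).hasFDerivAt.neg
    obtain ⟨-, hpsd⟩ :=
      (hg.isLocalMin_of_isMinOn hx hmin).gradient_eq_zero_and_hessian_nonneg hgrad hG
    obtain ⟨b, l, hb, -, hl⟩ := hg.exists_eigenbasis rfl hx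
    have h1 := hpos x hx
    rw [opSigma_of_eigenbasis b hb, Multiset.esymm_one] at h1
    refine absurd h1 (not_lt.2 (Finset.sum_nonpos fun i _ => ?_))
    rw [hl i]
    refine mul_nonpos_of_nonneg_of_nonpos (hg.q_pos hx).le ?_
    have h2 := hpsd (b i)
    rw [real_inner_comm]
    simpa using h2
  obtain ⟨z, hz, hmin⟩ := hg.isCompact_closure.exists_isMinOn
    hg.isConnected.nonempty.closure hg.continuousOn_u.neg
  rcases hg.mem_or_mem_frontier hz with hzΩ | hzf
  · exact absurd hmin (hno z hzΩ)
  · intro x hx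
    by_contra! hux
    refine hno x hx fun y hy => ?_
    have h1 : -u z ≤ -u y := hmin hy
    rw [hg.u_frontier z hzf] at h1
    change -u x ≤ -u y
    linarith

/-- The maximum principle for `c u - q`, first for `c < h`, where the elliptic inequality is
strict, and then in the limit. -/
theorem q_sub_le (hg : IsCappedGraph Ω u F q k K q₀) (hk1 : 1 ≤ k)
    (hk : k ≤ Module.finrank ℝ V) {h : ℝ}
    (hh : 0 < h) (hK : K = (Module.finrank ℝ V).choose k * h ^ k)
    (hpos : ∀ x ∈ Ω, ∀ j ≤ k, 0 < opSigma (fderiv ℝ F x) j) :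
    ∀ x ∈ Ω, q x - q₀ ≤ h * u x := by
  obtain ⟨j, rfl⟩ : ∃ j, k = j + 1 := ⟨k - 1, by omega⟩
  have hKpos : 0 < K := by
    obtain ⟨x, hx⟩ := hg.isConnected.nonempty
    rw [← hg.sigma_eq x hx]
    exact hpos x hx _ le_rfl
  have key : ∀ c < h, ∀ x ∈ Ω, -q₀ ≤ c * u x - q x := by
    intro c hc
    obtain ⟨z, hz, hmin⟩ := hg.isCompact_closure.exists_isMinOn
      hg.isConnected.nonempty.closure
      (((continuousOn_const (c := c)).mul hg.continuousOn_u).sub hg.continuousOn_q)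
    rcases hg.mem_or_mem_frontier hz with hzΩ | hzf
    · exfalso
      have h1 := hg.nonneg_of_isLocalMin rfl hg.sigma_eq hzΩ (hpos z hzΩ)
        (hg.isLocalMin_of_isMinOn hzΩ hmin)
      obtain ⟨b, l, hb, -, -⟩ := hg.exists_eigenbasis rfl hzΩ
      have hcard : (Finset.univ.val.map l).card = Module.finrank ℝ V := by simp
      have h2 := Multiset.le_esymm_one_mul_sub (s := Finset.univ.val.map l) hk1 (by rwa [hcard])
        (fun i hi => by rw [← opSigma_of_eigenbasis b hb]; exact hpos z hzΩ i hi) hh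
        (by rw [hcard, ← opSigma_of_eigenbasis b hb, hg.sigma_eq z hzΩ, hK])
      simp only [← opSigma_of_eigenbasis b hb] at h2
      rw [hg.sigma_eq z hzΩ] at h2
      push_cast at h2
      have h3 : c * ((j + 1) * K) < h * ((j + 1) * K) := by gcongr
      linarith
    · intro x hx
      have h1 : c * u z - q z ≤ c * u x - q x := hmin (subset_closure hx)
      rw [hg.u_frontier z hzf, hg.q_frontier z hzf] at h1
      linarith
  intro x hx
  have hlim : Tendsto (fun c => c * u x - q x) (𝓝[<] h) (𝓝 (h * u x - q x)) := by
    have : Continuous fun c => c * u x - q x := by fun_prop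
    exact (this.tendsto h).mono_left nhdsWithin_le_nhds
  have : -q₀ ≤ h * u x - q x := by
    refine ge_of_tendsto hlim ?_
    filter_upwards [self_mem_nhdsWithin] with c hc using key c hc x hx
  linarith

end IsCappedGraph

end CappedGraph

/-! ### The integral identity and rigidity -/

section Rigidity

open scoped InnerProductSpace Topology
open Filter MeasureTheory

variable {V : Type*} [NormedAddCommGroup V] [InnerProductSpace ℝ V] [FiniteDimensional ℝ V]
  {Ω : Set V} {u : V → ℝ} {F : V → V} {q : V → ℝ} {j : ℕ} {K q₀ : ℝ}

namespace IsCappedGraph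

/-- The divergence of `(q - q₀ - u A) T_j x` for constant `σ_{j+1}`: the first-order terms cancel
because `∇q = Aᵀ ∇u`. -/
theorem diver_identity (hg : IsCappedGraph Ω u F q (j + 1) K q₀) {x : V} (hx : x ∈ Ω) :
    diver (fun y => (q y - q₀) • newtonTensor (fderiv ℝ F y) j y -
      u y • fderiv ℝ F y (newtonTensor (fderiv ℝ F y) j y)) x =
      (Module.finrank ℝ V - j) * opSigma (fderiv ℝ F x) j * (q x - q₀) - (j + 1) * K * u x := by
  have hF := hg.contDiffAt hx
  have e : (fun y => (q y - q₀) • newtonTensor (fderiv ℝ F y) j y -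
      u y • fderiv ℝ F y (newtonTensor (fderiv ℝ F y) j y)) =ᶠ[𝓝 x]
      fun y => (q y - q₀) • newtonTensor (fderiv ℝ F y) j y -
        u y • (K • y - newtonTensor (fderiv ℝ F y) (j + 1) y) := by
    filter_upwards [hg.isOpen.mem_nhds hx] with y hy
    rw [newtonTensor_succ, hg.sigma_eq y hy, newtonTensor_mul_comm]
    simp
  have dT : ∀ j, DifferentiableAt ℝ (fun y => newtonTensor (fderiv ℝ F y) j y) x := fun j =>
    ((hF.newtonTensor_fderiv j).differentiableAt (by simp)).clm_apply differentiableAt_id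
  have dq : DifferentiableAt ℝ (fun y => q y - q₀) x :=
    ((hg.contDiffAt_q hx).differentiableAt (by simp)).sub_const q₀
  have du : DifferentiableAt ℝ u x := (hg.hasFDerivAt x hx).differentiableAt
  have dK : DifferentiableAt ℝ (fun y : V => K • y) x := by fun_prop
  have dKT : DifferentiableAt ℝ (fun y => K • y - newtonTensor (fderiv ℝ F y) (j + 1) y) x :=
    dK.sub (dT (j + 1))
  have d1 : DifferentiableAt ℝ (fun y => (q y - q₀) • newtonTensor (fderiv ℝ F y) j y) x :=
    dq.smul (dT j)
  have d2 : DifferentiableAt ℝ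
      (fun y => u y • (K • y - newtonTensor (fderiv ℝ F y) (j + 1) y)) x := du.smul dKT
  have hdT : ∀ j, diver (fun y => newtonTensor (fderiv ℝ F y) j y) x =
      (Module.finrank ℝ V - j) * opSigma (fderiv ℝ F x) j := by
    intro j
    rw [diver_newtonTensor hF (Y := fun y => y) differentiableAt_fun_id, fderiv_fun_id,
      ← opTrace_newtonTensor]
    rfl
  have hdK : diver (fun y : V => K • y) x = Module.finrank ℝ V * K := by
    rw [diver, fderiv_fun_const_smul differentiableAt_fun_id, map_smul]
    have := diver_id x
    rw [diver] at this
    rw [this, smul_eq_mul, mul_comm]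
  have hcomm : K • x - newtonTensor (fderiv ℝ F x) (j + 1) x =
      fderiv ℝ F x (newtonTensor (fderiv ℝ F x) j x) := by
    rw [newtonTensor_succ, hg.sigma_eq x hx, newtonTensor_mul_comm]
    simp
  rw [diver_congr e, diver_sub d1 d2, diver_smul dq (dT j), diver_smul du dKT,
    diver_sub dK (dT (j + 1)), hdT, hdT, hdK, hg.sigma_eq x hx, hcomm, fderiv_sub_const,
    hg.fderiv_q hx, (hg.hasFDerivAt x hx).fderiv]
  simp only [innerSL_apply_apply]
  push_cast
  ring

theorem continuousOn_integrand (hg : IsCappedGraph Ω u F q (j + 1) K q₀) :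
    ContinuousOn (fun x => (Module.finrank ℝ V - j) * opSigma (fderiv ℝ F x) j * (q x - q₀) -
      (j + 1) * K * u x) Ω :=
  ((continuousOn_const.mul (hg.continuousOn_opSigma j)).mul
    ((hg.continuousOn_q.mono subset_closure).sub continuousOn_const)).sub
    (continuousOn_const.mul (hg.continuousOn_u.mono subset_closure))

/-- Equality in the elliptic inequality makes the graph umbilic. -/
theorem fderiv_eq_smul (hg : IsCappedGraph Ω u F q (j + 1) K q₀)
    (hk : j + 1 ≤ Module.finrank ℝ V) {h : ℝ}
    (hh : 0 < h) (hK : K = (Module.finrank ℝ V).choose (j + 1) * h ^ (j + 1))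
    (hpos : ∀ x ∈ Ω, ∀ i ≤ j + 1, 0 < opSigma (fderiv ℝ F x) i)
    (hq : ∀ x ∈ Ω, q x = q₀ + h * u x) :
    ∀ x ∈ Ω, fderiv ℝ F x = h • ContinuousLinearMap.id ℝ V := by
  intro x hx
  have hmin : IsLocalMin (fun y => h * u y - q y) x := by
    filter_upwards [hg.isOpen.mem_nhds hx] with y hy
    rw [hq x hx, hq y hy]
    linarith
  have h1 := hg.nonneg_of_isLocalMin rfl hg.sigma_eq hx (hpos x hx) hmin
  obtain ⟨b, l, hb, -, -⟩ := hg.exists_eigenbasis rfl hx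
  have hcard : (Finset.univ.val.map l).card = Module.finrank ℝ V := by simp
  have hp : ∀ i ≤ j + 1, 0 < (Finset.univ.val.map l).esymm i := fun i hi => by
    rw [← opSigma_of_eigenbasis b hb]; exact hpos x hx i hi
  have hs : (Finset.univ.val.map l).esymm (j + 1) =
      (Finset.univ.val.map l).card.choose (j + 1) * h ^ (j + 1) := by
    rw [hcard, ← opSigma_of_eigenbasis b hb, hg.sigma_eq x hx, hK]
  have hkc : j + 1 ≤ (Finset.univ.val.map l).card := by rwa [hcard]
  have h2 := Multiset.le_esymm_one_mul_sub (Nat.le_add_left 1 j) hkc hp hh hs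
  have h3 : ((Finset.univ.val.map l).esymm 1 * (Finset.univ.val.map l).esymm (j + 1) -
      ((j + 1 : ℕ) + 1) * (Finset.univ.val.map l).esymm (j + 1 + 1) =
      h * ((j + 1 : ℕ) * (Finset.univ.val.map l).esymm (j + 1))) := by
    refine le_antisymm ?_ h2
    simp only [← opSigma_of_eigenbasis b hb]
    rw [hg.sigma_eq x hx]
    push_cast
    linarith
  have h4 := Multiset.eq_of_esymm_one_mul_sub_eq (Nat.le_add_left 1 j) hkc hp hh hs h3
  refine ContinuousLinearMap.coe_injective (b.ext fun i => ?_)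
  have h5 : l i = h := h4 _ (Multiset.mem_map_of_mem _ (Finset.mem_univ_val i))
  simp [hb, h5]

variable [MeasurableSpace V] [BorelSpace V]

/-- The integral identity behind the rigidity statement. The field vanishes at the boundary to the
order of `q₀ - q`, which dominates `|u|` by the maximum principle. -/
theorem integral_identity (hg : IsCappedGraph Ω u F q (j + 1) K q₀) {h : ℝ} (hh : 0 < h)
    (hu : ∀ x ∈ Ω, u x < 0) (hle : ∀ x ∈ Ω, q x - q₀ ≤ h * u x) :
    IntegrableOn (fun x => (Module.finrank ℝ V - j) * opSigma (fderiv ℝ F x) j * (q x - q₀) -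
      (j + 1) * K * u x) Ω ∧
    ∫ x in Ω, ((Module.finrank ℝ V - j) * opSigma (fderiv ℝ F x) j * (q x - q₀) -
      (j + 1) * K * u x) = 0 := by
  obtain ⟨C, hC⟩ := hg.exists_bound
  obtain ⟨R, hR⟩ := hg.isBounded.exists_norm_le
  have hball : IsCompact (Metric.closedBall (0 : V →L[ℝ] V) C) := isCompact_closedBall _ _
  obtain ⟨B, hB⟩ := hball.exists_bound_of_continuousOn
    (contDiff_newtonTensor (V := V) j).continuous.continuousOn
  obtain ⟨B', hB'⟩ := hball.exists_bound_of_continuousOn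
    (contDiff_opSigma (V := V) j).continuous.continuousOn
  have hmem : ∀ x ∈ Ω, fderiv ℝ F x ∈ Metric.closedBall (0 : V →L[ℝ] V) C := fun x hx => by
    simpa using hC x hx
  have hβ : ∀ x ∈ Ω, 0 < q₀ - q x := fun x hx => by
    have := hle x hx
    have := mul_neg_of_pos_of_neg hh (hu x hx)
    linarith
  have hub : ∀ x ∈ Ω, |u x| ≤ (q₀ - q x) / h := fun x hx => by
    rw [abs_of_neg (hu x hx), le_div_iff₀ hh]
    linarith [hle x hx]
  have hbd : ∀ x ∈ Ω, |(Module.finrank ℝ V - j) * opSigma (fderiv ℝ F x) j * (q x - q₀) -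
      (j + 1) * K * u x| ≤
      |(Module.finrank ℝ V - j : ℝ)| * B' * q₀ + |(j + 1) * K| * (q₀ / h) := by
    intro x hx
    have hs := hB' _ (hmem x hx)
    rw [Real.norm_eq_abs] at hs
    have hq1 : q₀ - q x ≤ q₀ := by linarith [hg.q_pos hx]
    have hB0 : 0 ≤ B' := (abs_nonneg _).trans hs
    refine (abs_sub _ _).trans ?_
    rw [abs_mul, abs_mul, abs_mul ((j + 1) * K), abs_sub_comm (q x), abs_of_pos (hβ x hx)]
    have hq0 : 0 ≤ q₀ - q x := (hβ x hx).le
    have hu' : |u x| ≤ q₀ / h := (hub x hx).trans (by gcongr)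
    gcongr
  refine ⟨IntegrableOn.of_bound hg.isBounded.measure_lt_top
    (hg.continuousOn_integrand.aestronglyMeasurable hg.isOpen.measurableSet) _
    ((ae_restrict_iff' hg.isOpen.measurableSet).2 (ae_of_all _ hbd)), ?_⟩
  rw [← setIntegral_diver_eq_zero hg.isOpen hg.isBounded (β := fun x => q₀ - q x)
    (X := fun y => (q y - q₀) • newtonTensor (fderiv ℝ F y) j y -
      u y • fderiv ℝ F y (newtonTensor (fderiv ℝ F y) j y))
    (C := C * (B * R + C * (B * R) / h))
    (D := |(Module.finrank ℝ V - j : ℝ)| * B' * q₀ + |(j + 1) * K| * (q₀ / h)) ?_ ?_ hβ ?_ ?_ ?_]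
  · exact setIntegral_congr_fun hg.isOpen.measurableSet fun x hx => (hg.diver_identity hx).symm
  · intro x hx
    have h3 : ContDiffAt ℝ 1 q x := (hg.contDiffAt_q hx).of_le (by simp)
    exact (contDiffAt_const.sub h3).contDiffWithinAt
  · intro x hx
    have hF := hg.contDiffAt hx
    have h0 : ContDiffAt ℝ 1 (fun y => newtonTensor (fderiv ℝ F y) j) x :=
      (hF.newtonTensor_fderiv j).of_le (by simp)
    have h1 : ContDiffAt ℝ 1 (fun y => newtonTensor (fderiv ℝ F y) j y) x :=
      h0.clm_apply contDiffAt_id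
    have h2 : ContDiffAt ℝ 1 (fderiv ℝ F) x :=
      (hF.fderiv_right (m := ∞) (by simp)).of_le (by simp)
    have h3 : ContDiffAt ℝ 1 q x := (hg.contDiffAt_q hx).of_le (by simp)
    exact (((h3.sub contDiffAt_const).smul h1).sub
      ((hg.contDiffAt_u hx).smul (h2.clm_apply h1))).contDiffWithinAt
  · intro ε hε
    have hcont : ContinuousOn (fun x => q₀ - q x) (closure Ω) :=
      continuousOn_const.sub hg.continuousOn_q
    have : {x ∈ Ω | ε ≤ q₀ - q x} = closure Ω ∩ (fun x => q₀ - q x) ⁻¹' Set.Ici ε := by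
      ext x
      constructor
      · rintro ⟨hx, h⟩
        exact ⟨subset_closure hx, h⟩
      · rintro ⟨hx, h⟩
        rcases hg.mem_or_mem_frontier hx with hx | hx
        · exact ⟨hx, h⟩
        · have h' : ε ≤ q₀ - q x := h
          rw [hg.q_frontier x hx] at h'
          linarith
    rw [this]
    exact hg.isCompact_closure.of_isClosed_subset
      (hcont.preimage_isClosed_of_isClosed isClosed_closure isClosed_Ici) Set.inter_subset_left
  · intro x hx
    have hA := hC x hx
    have hC0 : 0 ≤ C := (norm_nonneg _).trans hA
    have hT := hB _ (hmem x hx)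
    have hB0 : 0 ≤ B := (norm_nonneg _).trans hT
    have hTx : ‖newtonTensor (fderiv ℝ F x) j x‖ ≤ B * R :=
      (ContinuousLinearMap.le_opNorm _ _).trans (by gcongr; exact hR x hx)
    have hBR : 0 ≤ B * R := (norm_nonneg _).trans hTx
    have hATx : ‖fderiv ℝ F x (newtonTensor (fderiv ℝ F x) j x)‖ ≤ C * (B * R) :=
      (ContinuousLinearMap.le_opNorm _ _).trans (by gcongr)
    have hX : ‖(q x - q₀) • newtonTensor (fderiv ℝ F x) j x -
        u x • fderiv ℝ F x (newtonTensor (fderiv ℝ F x) j x)‖ ≤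
        (B * R + C * (B * R) / h) * (q₀ - q x) := by
      refine (norm_sub_le _ _).trans ?_
      rw [norm_smul, norm_smul, Real.norm_eq_abs, Real.norm_eq_abs, abs_sub_comm,
        abs_of_pos (hβ x hx)]
      calc _ ≤ (q₀ - q x) * (B * R) + (q₀ - q x) / h * (C * (B * R)) :=
            add_le_add (mul_le_mul_of_nonneg_left hTx (hβ x hx).le)
              (mul_le_mul (hub x hx) hATx (norm_nonneg _) (div_nonneg (hβ x hx).le hh.le))
        _ = _ := by ring
    have hG : ‖(q x)⁻¹ • F x‖ ≤ 1 := by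
      have hq := hg.q_pos hx
      rw [norm_smul, norm_inv, Real.norm_eq_abs, abs_of_pos hq, inv_mul_le_one₀ hq]
      refine (sq_le_sq₀ (norm_nonneg _) hq.le).1 ?_
      rw [hg.q_sq hx]; linarith
    rw [fderiv_const_sub, neg_apply, abs_neg, hg.fderiv_q hx]
    refine (abs_real_inner_le_norm _ _).trans ?_
    calc _ ≤ 1 * (C * ((B * R + C * (B * R) / h) * (q₀ - q x))) := by
          refine mul_le_mul hG ?_ (norm_nonneg _) zero_le_one
          exact (ContinuousLinearMap.le_opNorm _ _).trans
            (mul_le_mul hA hX (norm_nonneg _) hC0)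
      _ = _ := by ring
  · intro x hx
    rw [hg.diver_identity hx]
    exact hbd x hx

/-- Both parts of the integrand in `integral_identity` have a sign, so `q = q₀ + h u`. -/
theorem q_eq_add (hg : IsCappedGraph Ω u F q (j + 1) K q₀)
    (hk : j + 1 ≤ Module.finrank ℝ V) {h : ℝ}
    (hh : 0 < h) (hK : K = (Module.finrank ℝ V).choose (j + 1) * h ^ (j + 1))
    (hpos : ∀ x ∈ Ω, ∀ i ≤ j + 1, 0 < opSigma (fderiv ℝ F x) i)
    (hu : ∀ x ∈ Ω, u x < 0) (hle : ∀ x ∈ Ω, q x - q₀ ≤ h * u x) :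
    ∀ x ∈ Ω, q x = q₀ + h * u x := by
  set n := Module.finrank ℝ V with hn
  set I : V → ℝ := fun x => (n - j) * opSigma (fderiv ℝ F x) j * (q x - q₀) -
      (j + 1) * K * u x with hI
  have hjn : (0 : ℝ) < n - j := by
    have : ((j + 1 : ℕ) : ℝ) ≤ n := by exact_mod_cast hk
    push_cast at this
    linarith
  have hbin : (n.choose (j + 1) : ℝ) * (j + 1) = n.choose j * (n - j) := by
    have := Nat.choose_succ_right_eq n j
    rw [← Nat.cast_sub (by omega)]; exact_mod_cast this
  have hmac : ∀ x ∈ Ω, (j + 1) * K ≤ (n - j) * opSigma (fderiv ℝ F x) j * h := by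
    intro x hx
    obtain ⟨b, l, hb, -, -⟩ := hg.exists_eigenbasis rfl hx
    have hcard : (Finset.univ.val.map l).card = n := by simp [hn]
    have h1 := Multiset.maclaurin (s := Finset.univ.val.map l) (k := j + 1) (by rwa [hcard])
      (fun i hi => by rw [← opSigma_of_eigenbasis b hb]; exact hpos x hx i hi) hh
      (by rw [hcard, ← opSigma_of_eigenbasis b hb, hg.sigma_eq x hx, hK]) (Nat.le_succ j)
    rw [hcard, ← opSigma_of_eigenbasis b hb] at h1
    calc (j + 1) * K = (n - j) * (n.choose j * h ^ j) * h := by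
          rw [hK, pow_succ]
          linear_combination h ^ j * h * hbin
      _ ≤ _ := by gcongr
  have hdec : ∀ x, I x = (n - j) * opSigma (fderiv ℝ F x) j * (q x - q₀ - h * u x) +
      ((n - j) * opSigma (fderiv ℝ F x) j * h - (j + 1) * K) * u x := by
    intro x; rw [hI]; ring
  have hs1 : ∀ x ∈ Ω, (n - j) * opSigma (fderiv ℝ F x) j * (q x - q₀ - h * u x) ≤ 0 :=
    fun x hx => mul_nonpos_of_nonneg_of_nonpos
      (mul_pos hjn (hpos x hx j (Nat.le_succ j))).le (by linarith [hle x hx])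
  have hs2 : ∀ x ∈ Ω, ((n - j) * opSigma (fderiv ℝ F x) j * h - (j + 1) * K) * u x ≤ 0 :=
    fun x hx => mul_nonpos_of_nonneg_of_nonpos (by linarith [hmac x hx]) (hu x hx).le
  have hIle : ∀ x ∈ Ω, I x ≤ 0 := fun x hx => by rw [hdec]; linarith [hs1 x hx, hs2 x hx]
  obtain ⟨hii, hint⟩ : IntegrableOn I Ω ∧ ∫ x in Ω, I x = 0 := hg.integral_identity hh hu hle
  have hI0 : Set.EqOn I 0 Ω := by
    have h1 : ∫ x in Ω, -I x = 0 := by rw [integral_neg, hint, neg_zero]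
    have h2 := (setIntegral_eq_zero_iff_of_nonneg_ae
      ((ae_restrict_iff' hg.isOpen.measurableSet).2
        (ae_of_all _ fun x hx => by simpa using hIle x hx)) hii.neg).1 h1
    have h3 : I =ᵐ[volume.restrict Ω] 0 := by
      filter_upwards [h2] with x hx
      simpa using hx
    exact Measure.eqOn_open_of_ae_eq h3 hg.isOpen hg.continuousOn_integrand continuousOn_const
  intro x hx
  have h1 : I x = 0 := hI0 hx
  rw [hdec] at h1
  have h2 : (n - j) * opSigma (fderiv ℝ F x) j * (q x - q₀ - h * u x) = 0 := by
    linarith [hs1 x hx, hs2 x hx]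
  rcases mul_eq_zero.1 h2 with h3 | h3
  · exact absurd h3 (mul_pos hjn (hpos x hx j (Nat.le_succ j))).ne'
  · linarith

/-- The graph is a cap of a hyperboloid. -/
theorem exists_hyperboloid (hg : IsCappedGraph Ω u F q (j + 1) K q₀)
    (hk : j + 1 ≤ Module.finrank ℝ V) {x₀ : V} (hx₀ : x₀ ∈ Ω) (hux₀ : u x₀ < 0) :
    ∃ (a : V) (r : ℝ), 0 < r ∧ K * r ^ (j + 1) = (Module.finrank ℝ V).choose (j + 1) ∧
      Ω = {x | ‖x - a‖ ^ 2 < r ^ 2 * (q₀ ^ 2 - 1)} ∧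
      ∀ x ∈ closure Ω, u x = √(r ^ 2 + ‖x - a‖ ^ 2) - r * q₀ := by
  obtain ⟨x₁, hx₁, hx₁pos⟩ := hg.exists_sigma_pos hx₀ hux₀
  have hbin : (0 : ℝ) < (Module.finrank ℝ V).choose (j + 1) := by
    exact_mod_cast Nat.choose_pos hk
  have hKpos : 0 < K := by
    rw [← hg.sigma_eq x₁ hx₁]
    exact hx₁pos _ hk
  obtain ⟨h, hh, hhK⟩ : ∃ h : ℝ, 0 < h ∧ h ^ (j + 1) = K / (Module.finrank ℝ V).choose (j + 1) :=
    ⟨(K / (Module.finrank ℝ V).choose (j + 1)) ^ (((j + 1 : ℕ) : ℝ)⁻¹),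
      Real.rpow_pos_of_pos (div_pos hKpos hbin) _,
      Real.rpow_inv_natCast_pow (div_pos hKpos hbin).le (Nat.succ_ne_zero j)⟩
  have hK : K = (Module.finrank ℝ V).choose (j + 1) * h ^ (j + 1) := by
    rw [hhK]; field_simp
  have hpos := hg.sigma_pos hk hh hK ⟨x₁, hx₁, fun i hi => hx₁pos i (hi.trans hk)⟩
  have hu := hg.u_neg fun x hx => hpos x hx 1 (Nat.le_add_left 1 j)
  have hle := hg.q_sub_le (Nat.le_add_left 1 j) hk hh hK hpos
  have hq := hg.q_eq_add hk hh hK hpos hu hle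
  have hA := hg.fderiv_eq_smul hk hh hK hpos hq
  have hFd : ∀ x ∈ Ω, DifferentiableAt ℝ F x := fun x hx =>
    (hg.contDiffAt hx).differentiableAt (by simp)
  obtain ⟨c, hc⟩ : ∃ c, ∀ x ∈ Ω, F x - h • x = c := by
    refine hg.isOpen.exists_is_const_of_fderiv_eq_zero hg.isConnected.isPreconnected
      (fun x hx => ((hFd x hx).sub (by fun_prop)).differentiableWithinAt) fun x hx => ?_
    have h1 : HasFDerivAt (fun x => F x - h • x) _ x :=
      (hFd x hx).hasFDerivAt.sub ((hasFDerivAt_id x).const_smul h)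
    rw [h1.fderiv, hA x hx, sub_self]
    rfl
  set a : V := -(h⁻¹ • c) with ha
  have hF : ∀ x ∈ Ω, F x = h • (x - a) := by
    intro x hx
    rw [ha, sub_neg_eq_add, smul_add, smul_inv_smul₀ hh.ne', ← hc x hx]
    abel
  have huΩ : ∀ x ∈ Ω, u x = √(h⁻¹ ^ 2 + ‖x - a‖ ^ 2) - h⁻¹ * q₀ := by
    intro x hx
    have h1 := hq x hx
    rw [hg.q_eq x hx, hF x hx, norm_smul, Real.norm_eq_abs, abs_of_pos hh] at h1
    have h2 : 1 + (h * ‖x - a‖) ^ 2 = h ^ 2 * (h⁻¹ ^ 2 + ‖x - a‖ ^ 2) := by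
      field_simp
    rw [h2, Real.sqrt_mul (by positivity), Real.sqrt_sq hh.le] at h1
    rw [← inv_mul_cancel_left₀ hh.ne' √(h⁻¹ ^ 2 + ‖x - a‖ ^ 2), h1, mul_add,
      inv_mul_cancel_left₀ hh.ne']
    ring
  have hucl : ∀ x ∈ closure Ω, u x = √(h⁻¹ ^ 2 + ‖x - a‖ ^ 2) - h⁻¹ * q₀ := by
    have := (show Set.EqOn u (fun x => √(h⁻¹ ^ 2 + ‖x - a‖ ^ 2) - h⁻¹ * q₀) Ω from huΩ).of_subset_closure
      hg.continuousOn_u (by fun_prop) subset_closure le_rfl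
    exact this
  have hq₀ : 0 ≤ q₀ := by
    have h1 := hle x₀ hx₀
    have h2 := mul_neg_of_pos_of_neg hh hux₀
    linarith [hg.one_le_q hx₀]
  refine ⟨a, h⁻¹, inv_pos.2 hh, ?_, ?_, hucl⟩
  · rw [hK, inv_pow]; field_simp
  · have hlt : ∀ x ∈ closure Ω, u x < 0 → ‖x - a‖ ^ 2 < h⁻¹ ^ 2 * (q₀ ^ 2 - 1) := by
      intro x hx hux
      rw [hucl x hx, sub_neg, Real.sqrt_lt' ] at hux
      · nlinarith
      · by_contra! hneg
        exact absurd ((Real.sqrt_nonneg _).trans_lt hux) (not_lt.2 hneg)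
    refine Set.Subset.antisymm (fun x hx => hlt x (subset_closure hx) (hu x hx)) ?_
    have hB : {x : V | ‖x - a‖ ^ 2 < h⁻¹ ^ 2 * (q₀ ^ 2 - 1)} =
        Metric.ball a √(h⁻¹ ^ 2 * (q₀ ^ 2 - 1)) := by
      ext x
      rw [Metric.mem_ball, dist_eq_norm, Real.lt_sqrt (norm_nonneg _)]
      rfl
    refine IsPreconnected.subset_of_closure_inter_subset ?_ hg.isOpen
      ⟨x₀, hlt x₀ (subset_closure hx₀) hux₀, hx₀⟩ ?_
    · rw [hB]
      exact (convex_ball _ _).isPreconnected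
    · rintro x ⟨hx, hxB⟩
      rcases hg.mem_or_mem_frontier hx with h1 | h1
      · exact h1
      · exfalso
        have h2 := hg.u_frontier x h1
        rw [hucl x hx, sub_eq_zero, Real.sqrt_eq_iff_mul_self_eq (by positivity) (by positivity)] at h2
        have h3 : ‖x - a‖ ^ 2 < h⁻¹ ^ 2 * (q₀ ^ 2 - 1) := hxB
        nlinarith

end IsCappedGraph

end Rigidity

/-! ### Reflection, and bounds up to the boundary -/

section Reflection

variable {V : Type*} [NormedAddCommGroup V] [InnerProductSpace ℝ V] [FiniteDimensional ℝ V]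

/-- Reflection in the hyperplane `u = 0`. -/
theorem IsCappedGraph.neg {Ω : Set V} {u : V → ℝ} {F : V → V} {q : V → ℝ} {k : ℕ} {K q₀ : ℝ}
    (hg : IsCappedGraph Ω u F q k K q₀) :
    IsCappedGraph Ω (fun x => -u x) (fun x => -F x) q k ((-1) ^ k * K) q₀ where
  isOpen := hg.isOpen
  contDiffOn := hg.contDiffOn.neg
  q_eq x hx := by rw [hg.q_eq x hx, norm_neg]
  hasFDerivAt x hx := by
    rw [smul_neg, map_neg]
    exact (hg.hasFDerivAt x hx).neg
  isConnected := hg.isConnected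
  isBounded := hg.isBounded
  continuousOn_u := hg.continuousOn_u.neg
  continuousOn_q := hg.continuousOn_q
  u_frontier x hx := by rw [hg.u_frontier x hx, neg_zero]
  q_frontier := hg.q_frontier
  sigma_eq x hx := by
    rw [fderiv_fun_neg, ← neg_one_smul ℝ (fderiv ℝ F x), opSigma_smul, hg.sigma_eq x hx]
  exists_bound := by
    obtain ⟨C, hC⟩ := hg.exists_bound
    exact ⟨C, fun x hx => by rw [fderiv_fun_neg, norm_neg]; exact hC x hx⟩

end Reflection

/-- A function which is `C¹` up to the boundary of a bounded open set has bounded derivative. -/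
theorem exists_bound_fderiv_of_contDiffOn_closure {V W : Type*} [NormedAddCommGroup V]
    [NormedSpace ℝ V] [NormedAddCommGroup W] [NormedSpace ℝ W] {Ω : Set V} (hΩ : IsOpen Ω)
    (hc : IsCompact (closure Ω)) {f : V → W} (hf : ContDiffOn ℝ 1 f (closure Ω)) :
    ∃ C, ∀ x ∈ Ω, ‖fderiv ℝ f x‖ ≤ C := by
  suffices h : ∃ C, ∀ x ∈ closure Ω ∩ Ω, ‖fderiv ℝ f x‖ ≤ C by
    obtain ⟨C, hC⟩ := h
    exact ⟨C, fun x hx => hC x ⟨subset_closure hx, hx⟩⟩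
  refine hc.induction_on (p := fun t => ∃ C, ∀ x ∈ t ∩ Ω, ‖fderiv ℝ f x‖ ≤ C)
    ⟨0, by simp⟩ ?_ ?_ ?_
  · rintro s t hst ⟨C, hC⟩
    exact ⟨C, fun x hx => hC x ⟨hst hx.1, hx.2⟩⟩
  · rintro s t ⟨C, hC⟩ ⟨D, hD⟩
    refine ⟨max C D, ?_⟩
    rintro x ⟨hx | hx, hxΩ⟩
    · exact (hC x ⟨hx, hxΩ⟩).trans (le_max_left _ _)
    · exact (hD x ⟨hx, hxΩ⟩).trans (le_max_right _ _)
  · intro x hx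
    have h1 : ContDiffWithinAt ℝ (0 + 1) f (closure Ω) x := by simpa using hf x hx
    obtain ⟨s, hs, -, f', hf', hc'⟩ :=
      (contDiffWithinAt_succ_iff_hasFDerivWithinAt (by simp)).1 h1
    rw [Set.insert_eq_of_mem hx] at hs
    have hcont : ContinuousWithinAt f' s x := hc'.continuousWithinAt
    have hb : ∀ᶠ y in nhdsWithin x s, ‖f' y‖ < ‖f' x‖ + 1 :=
      hcont.norm.eventually (gt_mem_nhds (lt_add_one _))
    have hb' : ∀ᶠ y in nhdsWithin x (closure Ω), ‖f' y‖ < ‖f' x‖ + 1 :=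
      hb.filter_mono (nhdsWithin_le_of_mem hs)
    obtain ⟨O, hO, hxO, hOs⟩ := mem_nhdsWithin.1 hs
    refine ⟨O ∩ closure Ω ∩ {y | ‖f' y‖ < ‖f' x‖ + 1},
      Filter.inter_mem (Filter.inter_mem (mem_nhdsWithin_of_mem_nhds (hO.mem_nhds hxO))
        self_mem_nhdsWithin) hb', ‖f' x‖ + 1, ?_⟩
    rintro y ⟨⟨⟨hyO, -⟩, hy⟩, hyΩ⟩
    have hsy : s ∈ nhds y := by
      filter_upwards [hO.mem_nhds hyO, hΩ.mem_nhds hyΩ] with z hz hz'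
      exact hOs ⟨hz, subset_closure hz'⟩
    rw [((hf' y (mem_of_mem_nhds hsy)).hasFDerivAt hsy).fderiv]
    exact le_of_lt hy

/-! ### Linear coordinates adapted to a spacelike hyperplane -/

section Minkowski

open scoped InnerProductSpace

variable {n : ℕ}

theorem mdot_comm (Y Z : Mink n) : mdot Y Z = mdot Z Y := by
  rw [mdot, mdot, real_inner_comm, mul_comm]

theorem mdot_add_left (X Y Z : Mink n) : mdot (X + Y) Z = mdot X Z + mdot Y Z := by
  simp only [mdot, Prod.fst_add, Prod.snd_add, inner_add_left]; ring

theorem mdot_smul_left (c : ℝ) (Y Z : Mink n) : mdot (c • Y) Z = c * mdot Y Z := by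
  simp only [mdot, Prod.smul_fst, Prod.smul_snd, real_inner_smul_left, smul_eq_mul]; ring

theorem mdot_add_right (X Y Z : Mink n) : mdot X (Y + Z) = mdot X Y + mdot X Z := by
  rw [mdot_comm, mdot_add_left, mdot_comm Y, mdot_comm Z]

theorem mdot_smul_right (c : ℝ) (Y Z : Mink n) : mdot Y (c • Z) = c * mdot Y Z := by
  rw [mdot_comm, mdot_smul_left, mdot_comm]

/-- The Lorentzian scalar product as a bilinear form. -/
noncomputable def mdotForm (n : ℕ) : LinearMap.BilinForm ℝ (Mink n) :=
  LinearMap.mk₂ ℝ mdot mdot_add_left mdot_smul_left mdot_add_right mdot_smul_right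

/-- The direction space of a spacelike hyperplane is isometric to Euclidean space. -/
theorem IsSpacelikeHyperplane.exists_isometry {P : AffineSubspace ℝ (Mink n)}
    (hP : IsSpacelikeHyperplane P) :
    ∃ e : EuclideanSpace ℝ (Fin n) ≃L[ℝ] P.direction,
      ∀ v w, mdot (e v : Mink n) (e w : Mink n) = ⟪v, w⟫_ℝ := by
  set B : LinearMap.BilinForm ℝ P.direction :=
    (mdotForm n).compl₁₂ P.direction.subtype P.direction.subtype with hB
  have hBa : ∀ v w : P.direction, B v w = mdot (v : Mink n) (w : Mink n) := fun v w => rfl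
  have hsymm : LinearMap.IsSymm B := ⟨fun v w => by
    rw [hBa, hBa, mdot_comm]; rfl⟩
  obtain ⟨v', hv'⟩ := LinearMap.BilinForm.exists_orthogonal_basis hsymm
  set v := v'.reindex (finCongr hP.finrank_direction) with hv
  have hortho : ∀ i j, i ≠ j → B (v i) (v j) = 0 := by
    intro i j hij
    rw [hv, Module.Basis.reindex_apply, Module.Basis.reindex_apply]
    exact hv' (fun h => hij ((finCongr hP.finrank_direction).symm.injective h))
  have hpos : ∀ i, 0 < B (v i) (v i) := fun i =>
    hP.spacelike _ (v i).2 (fun h => v.ne_zero i (Subtype.ext h))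
  set w : Fin n → P.direction := fun i => (√(B (v i) (v i)))⁻¹ • v i with hw
  have hww : ∀ i j, B (w i) (w j) = if i = j then 1 else 0 := by
    intro i j
    simp only [hw, map_smul, LinearMap.smul_apply, smul_eq_mul]
    split_ifs with h
    · subst h
      have h1 := Real.sqrt_pos.2 (hpos i)
      have h2 := Real.mul_self_sqrt (hpos i).le
      field_simp
      linarith
    · rw [hortho i j h, mul_zero, mul_zero]
  set L : EuclideanSpace ℝ (Fin n) →ₗ[ℝ] P.direction :=
    Fintype.linearCombination ℝ w ∘ₗ (WithLp.linearEquiv 2 ℝ (Fin n → ℝ)).toLinearMap with hL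
  have hLa : ∀ x, L x = ∑ i, x i • w i := fun x => by
    simp [hL, Fintype.linearCombination_apply]
  have hLi : ∀ x y, B (L x) (L y) = ⟪x, y⟫_ℝ := by
    intro x y
    simp only [hLa, map_sum, map_smul, LinearMap.sum_apply, LinearMap.smul_apply, hww,
      smul_eq_mul, PiLp.inner_apply]
    refine Finset.sum_congr rfl fun i _ => ?_
    simp [mul_comm]
  have hinj : Function.Injective L := by
    rw [injective_iff_map_eq_zero]
    intro x hx
    have h1 := hLi x x
    rw [hx, map_zero] at h1
    exact inner_self_eq_zero.1 h1.symm
  have hdim : Module.finrank ℝ (EuclideanSpace ℝ (Fin n)) = Module.finrank ℝ P.direction := by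
    rw [hP.finrank_direction, finrank_euclideanSpace_fin]
  exact ⟨(LinearEquiv.ofBijective L ⟨hinj,
    (LinearMap.injective_iff_surjective_of_finrank_eq_finrank hdim).1 hinj⟩).toContinuousLinearEquiv,
    hLi⟩

/-- A Lorentz transformation taking the horizontal hyperplane to the direction space of `P` and
the time direction to the normal `N₀`. -/
theorem IsTimelikeUnitNormal.exists_lorentz {P : AffineSubspace ℝ (Mink n)}
    {N₀ : Mink n} (hN₀ : IsTimelikeUnitNormal P N₀)
    (e : EuclideanSpace ℝ (Fin n) ≃L[ℝ] P.direction)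
    (he : ∀ v w, mdot (e v : Mink n) (e w : Mink n) = ⟪v, w⟫_ℝ) :
    ∃ Φ : Mink n ≃L[ℝ] Mink n, (∀ v c, Φ (v, c) = (e v : Mink n) + c • N₀) ∧
      ∀ Y Z, mdot (Φ Y) (Φ Z) = mdot Y Z := by
  set L : Mink n →ₗ[ℝ] Mink n :=
    (P.direction.subtype ∘ₗ e.toLinearEquiv.toLinearMap ∘ₗ LinearMap.fst ℝ _ ℝ) +
      (LinearMap.snd ℝ (EuclideanSpace ℝ (Fin n)) ℝ).smulRight N₀ with hL
  have hLa : ∀ v c, L (v, c) = (e v : Mink n) + c • N₀ := fun v c => by simp [hL]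
  have hn1 : ∀ v, mdot N₀ (e v : Mink n) = 0 := fun v => hN₀.normal _ (e v).2
  have hLi : ∀ Y Z, mdot (L Y) (L Z) = mdot Y Z := by
    rintro ⟨v, c⟩ ⟨w, d⟩
    rw [hLa, hLa]
    simp only [mdot_add_left, mdot_add_right, mdot_smul_left, mdot_smul_right, he, hn1,
      mdot_comm _ N₀, hN₀.unit]
    simp only [mdot]
    ring
  have hinj : Function.Injective L := by
    rw [injective_iff_map_eq_zero]
    intro Y hY
    have h0 : ∀ Z, mdot Y Z = 0 := fun Z => by
      rw [← hLi, hY]; simp [mdot]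
    have h1 := h0 (Y.1, 0)
    have h2 := h0 (0, 1)
    simp only [mdot, mul_zero, sub_zero, inner_self_eq_zero] at h1
    simp only [mdot, inner_zero_right, mul_one, zero_sub, neg_eq_zero] at h2
    exact Prod.ext h1 h2
  exact ⟨(LinearEquiv.ofBijective L ⟨hinj,
    LinearMap.injective_iff_surjective.1 hinj⟩).toContinuousLinearEquiv, hLa, hLi⟩

end Minkowski

/-! ### From Minkowski space to Euclidean coordinates -/

section Transfer

open scoped InnerProductSpace Topology
open Filter

variable {n : ℕ} {P : AffineSubspace ℝ (Mink n)} {p₀ N₀ : Mink n} {Ω : Set P.direction}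
  {u : P.direction → ℝ} {N : P.direction → Mink n}
  {e : EuclideanSpace ℝ (Fin n) ≃L[ℝ] P.direction} {Φ : Mink n ≃L[ℝ] Mink n}

theorem fderivWithin_graphMap (hΩ : IsOpen Ω) (hΦ : ∀ v c, Φ (v, c) = (e v : Mink n) + c • N₀)
    {x : P.direction} (hx : x ∈ Ω) (hu : DifferentiableAt ℝ u x) (v : EuclideanSpace ℝ (Fin n)) :
    fderivWithin ℝ (graphMap p₀ N₀ u) (closure Ω) x (e v) = Φ (v, fderiv ℝ u x (e v)) := by
  have h1 : HasFDerivAt (graphMap p₀ N₀ u)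
      (P.direction.subtypeL + (fderiv ℝ u x).smulRight N₀) x :=
    ((P.direction.subtypeL.hasFDerivAt).const_add p₀).add (hu.hasFDerivAt.smul_const N₀)
  rw [fderivWithin_of_mem_nhds (mem_of_superset (hΩ.mem_nhds hx) subset_closure), h1.fderiv, hΦ]
  simp

/-- The unit normal of the graph in Lorentz coordinates: `N = (F', q')` with
`q'² = 1 + ‖F'‖²` and `∇u = F' / q'`, and the shape operator is the derivative of `F'`. -/
theorem normal_coordinates (hΩ : IsOpen Ω) (hΦ : ∀ v c, Φ (v, c) = (e v : Mink n) + c • N₀)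
    (hΦm : ∀ Y Z, mdot (Φ Y) (Φ Z) = mdot Y Z) (hu : ContDiffOn ℝ ∞ u (closure Ω))
    (hN : IsUnitNormalField (graphMap p₀ N₀ u) N (closure Ω)) {x : EuclideanSpace ℝ (Fin n)}
    (hx : e x ∈ Ω) :
    HasFDerivAt (fun y => u (e y))
      (innerSL ℝ ((Φ.symm (N (e x))).2⁻¹ • (Φ.symm (N (e x))).1)) x ∧
    shapeOperator (graphMap p₀ N₀ u) N (closure Ω) (e x) =
      e.toLinearEquiv.conj (fderiv ℝ (fun y => (Φ.symm (N (e y))).1) x : _ →ₗ[ℝ] _) := by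
  have hcl : closure Ω ∈ 𝓝 (e x) := mem_of_superset (hΩ.mem_nhds hx) subset_closure
  have hud : DifferentiableAt ℝ u (e x) := (hu.contDiffAt hcl).differentiableAt (by simp)
  have hNd : DifferentiableAt ℝ N (e x) :=
    (hN.contDiffOn.contDiffAt hcl).differentiableAt (by simp)
  have hmem : e x ∈ closure Ω := subset_closure hx
  set Z : EuclideanSpace ℝ (Fin n) → Mink n := fun y => Φ.symm (N (e y)) with hZ
  have hZN : ∀ y, N (e y) = Φ (Z y) := fun y => (Φ.apply_symm_apply _).symm
  have hunit : ∀ y, e y ∈ closure Ω → ⟪(Z y).1, (Z y).1⟫_ℝ - (Z y).2 * (Z y).2 = -1 := by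
    intro y hy
    have := hN.unit _ hy
    rw [hZN, hΦm] at this
    exact this
  have hq0 : (Z x).2 ≠ 0 := by
    intro h0
    have h1 := hunit x hmem
    rw [h0] at h1
    linarith [real_inner_self_nonneg (x := (Z x).1)]
  have hnormal : ∀ w, fderiv ℝ u (e x) (e w) = ⟪(Z x).2⁻¹ • (Z x).1, w⟫_ℝ := by
    intro w
    have h1 := hN.normal _ hmem (e w)
    rw [fderivWithin_graphMap hΩ hΦ hx hud, hZN, hΦm] at h1
    simp only [mdot] at h1
    rw [real_inner_smul_left]
    field_simp
    linarith
  have hZd : HasFDerivAt Z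
      ((Φ.symm : Mink n →L[ℝ] Mink n).comp ((fderiv ℝ N (e x)).comp (e : _ →L[ℝ] P.direction))) x :=
    Φ.symm.hasFDerivAt.comp x (hNd.hasFDerivAt.comp x e.hasFDerivAt)
  have hZ1 : HasFDerivAt (fun y => (Z y).1) _ x := hZd.fst
  have hZ2 : HasFDerivAt (fun y => (Z y).2) _ x := hZd.snd
  refine ⟨?_, ?_⟩
  · have h1 : HasFDerivAt (fun y => u (e y))
        ((fderiv ℝ u (e x)).comp (e : _ →L[ℝ] P.direction)) x :=
      hud.hasFDerivAt.comp x e.hasFDerivAt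
    refine h1.congr_fderiv ?_
    ext w
    exact hnormal w
  · set D := fderiv ℝ (fun y => (Z y).1) x with hD
    -- Differentiating the normalization gives `q' ∇q' = (∇F')ᵀ F'`, so `dN` is `dX ∘ ∇F'`.
    have hq' : ∀ w, fderiv ℝ (fun y => (Z y).2) x w = ⟪(Z x).2⁻¹ • (Z x).1, D w⟫_ℝ := by
      intro w
      have h1 : HasFDerivAt (fun y => ⟪(Z y).1, (Z y).1⟫_ℝ - (Z y).2 * (Z y).2) _ x :=
        (hZ1.inner ℝ hZ1).sub (hZ2.mul hZ2)
      have h2 : (fun y => ⟪(Z y).1, (Z y).1⟫_ℝ - (Z y).2 * (Z y).2) =ᶠ[𝓝 x] fun _ => -1 := by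
        filter_upwards [e.continuous.continuousAt.preimage_mem_nhds hcl] with y hy using hunit y hy
      have h3 := h1.fderiv
      rw [h2.fderiv_eq] at h3
      have h4 := DFunLike.congr_fun h3 w
      rw [hD, hZ1.fderiv, hZ2.fderiv, real_inner_smul_left]
      simp at h4
      simp
      field_simp
      linarith [real_inner_comm (Z x).1 (Φ.symm (fderiv ℝ N (e x) (e w))).1]
    have key : ∀ w, fderivWithin ℝ N (closure Ω) (e x) (e w) =
        fderivWithin ℝ (graphMap p₀ N₀ u) (closure Ω) (e x) (e (D w)) := by
      intro w
      rw [fderivWithin_graphMap hΩ hΦ hx hud, hnormal, ← hq', fderivWithin_of_mem_nhds hcl,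
        hD, hZ1.fderiv, hZ2.fderiv]
      simp
    have hinj : LinearMap.ker
        (fderivWithin ℝ (graphMap p₀ N₀ u) (closure Ω) (e x)).toLinearMap = ⊥ := by
      rw [LinearMap.ker_eq_bot']
      intro v hv
      obtain ⟨w, rfl⟩ := e.surjective v
      have h1 : Φ (w, fderiv ℝ u (e x) (e w)) = 0 := by
        rw [← fderivWithin_graphMap hΩ hΦ hx hud]
        exact hv
      have h2 := congrArg Prod.fst ((map_eq_zero_iff Φ Φ.injective).1 h1)
      have h3 : w = 0 := h2
      rw [h3, map_zero]
    refine LinearMap.ext fun v => ?_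
    obtain ⟨w, rfl⟩ := e.surjective v
    rw [shapeOperator, LinearMap.comp_apply]
    refine (congrArg _ (key w)).trans ?_
    refine (LinearMap.leftInverse_apply_of_inj hinj _).trans ?_
    rw [LinearEquiv.conj_apply_apply]
    simp

/-- In Lorentz coordinates a graph as in the theorem is a capped graph over a domain of Euclidean
space; the normal is replaced by the one with `q > 0`. -/
theorem exists_isCappedGraph {k : ℕ} (hkn : k ≤ n) (hN₀ : IsTimelikeUnitNormal P N₀) (hp₀ : p₀ ∈ P)
    (hΩ : IsOpen Ω) (hΩc : IsConnected Ω) (hΩb : Bornology.IsBounded Ω)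
    (hΦ : ∀ v c, Φ (v, c) = (e v : Mink n) + c • N₀)
    (hΦm : ∀ Y Z, mdot (Φ Y) (Φ Z) = mdot Y Z) (hu : ContDiffOn ℝ ∞ u (closure Ω))
    (hN : IsUnitNormalField (graphMap p₀ N₀ u) N (closure Ω))
    {H : ℝ} (hH : ∀ x ∈ closure Ω, meanCurvature k (graphMap p₀ N₀ u) N (closure Ω) x = H)
    (hbdry : ∀ x ∈ frontier Ω, graphMap p₀ N₀ u x ∈ P)
    {θ₀ : ℝ} (hθ : ∀ x ∈ frontier Ω, mdot (N x) N₀ = θ₀) :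
    ∃ (F : EuclideanSpace ℝ (Fin n) → EuclideanSpace ℝ (Fin n))
      (q : EuclideanSpace ℝ (Fin n) → ℝ) (s : ℝ), (s = 1 ∨ s = -1) ∧
      IsCappedGraph (e ⁻¹' Ω) (fun x => u (e x)) F q k (s ^ k * (H * n.choose k)) |θ₀| := by
  set Z : EuclideanSpace ℝ (Fin n) → Mink n := fun y => Φ.symm (N (e y)) with hZ
  set Ω' := e ⁻¹' Ω with hΩ'
  have hΩ'o : IsOpen Ω' := hΩ.preimage e.continuous
  have hcl : closure Ω' = e ⁻¹' closure Ω := (e.toHomeomorph.preimage_closure Ω).symm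
  have hfr : frontier Ω' = e ⁻¹' frontier Ω := (e.toHomeomorph.preimage_frontier Ω).symm
  have hΩ'c : IsConnected Ω' := e.toHomeomorph.isConnected_preimage.2 hΩc
  have hΩ'b : Bornology.IsBounded Ω' := by
    rw [hΩ', ← e.image_symm_eq_preimage]
    exact (e.symm : P.direction →L[ℝ] EuclideanSpace ℝ (Fin n)).lipschitz.isBounded_image hΩb
  have hZN : ∀ y, N (e y) = Φ (Z y) := fun y => (Φ.apply_symm_apply _).symm
  have hunit : ∀ y ∈ closure Ω', (Z y).2 ^ 2 = 1 + ‖(Z y).1‖ ^ 2 := by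
    intro y hy
    rw [hcl] at hy
    have h1 := hN.unit _ hy
    rw [hZN, hΦm, mdot, real_inner_self_eq_norm_sq] at h1
    linarith
  have hZc : ContDiffOn ℝ ∞ Z (closure Ω') := by
    rw [hcl]
    exact Φ.symm.contDiff.comp_contDiffOn (hN.contDiffOn.comp e.contDiff.contDiffOn fun _ h => h)
  have hZ1 : ContDiffOn ℝ ∞ (fun y => (Z y).1) (closure Ω') := contDiff_fst.comp_contDiffOn hZc
  have hZ2 : ContDiffOn ℝ ∞ (fun y => (Z y).2) (closure Ω') := contDiff_snd.comp_contDiffOn hZc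
  obtain ⟨s, hs, hsq⟩ : ∃ s : ℝ, (s = 1 ∨ s = -1) ∧
      ∀ x ∈ closure Ω', s * (Z x).2 = √(1 + ‖(Z x).1‖ ^ 2) := by
    have hc : ContinuousOn (fun x => √(1 + ‖(Z x).1‖ ^ 2)) (closure Ω') :=
      (continuousOn_const.add (hZ1.continuousOn.norm.pow 2)).sqrt
    rcases hΩ'c.isPreconnected.closure.eq_or_eq_neg_of_sq_eq hZ2.continuousOn hc
      (fun x hx => by
        simp only [Pi.pow_apply]
        rw [hunit x hx, Real.sq_sqrt (by positivity)])
      (fun {x} hx => by positivity) with h | h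
    · exact ⟨1, Or.inl rfl, fun x hx => by rw [one_mul]; exact h hx⟩
    · refine ⟨-1, Or.inr rfl, fun x hx => ?_⟩
      have := h hx
      simp only [Pi.neg_apply] at this
      rw [this]; ring
  have hss : s * s = 1 := by rcases hs with rfl | rfl <;> norm_num
  have hs0 : s ≠ 0 := by rintro rfl; norm_num at hss
  have hus : ContinuousOn (fun x => u (e x)) (closure Ω') := by
    rw [hcl]
    exact hu.continuousOn.comp e.continuous.continuousOn fun _ h => h
  have hgd : IsGraphData Ω' (fun x => u (e x)) (fun x => s • (Z x).1) (fun x => s * (Z x).2) := by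
    refine ⟨hΩ'o, ?_, ?_, ?_⟩
    · exact (hZ1.mono subset_closure).const_smul s
    · intro x hx
      rw [hsq x (subset_closure hx), norm_smul, mul_pow, Real.norm_eq_abs, sq_abs, sq s, hss,
        one_mul]
    · intro x hx
      have h1 := (normal_coordinates hΩ hΦ hΦm hu hN hx).1
      have h2 : (s * (Z x).2)⁻¹ • s • (Z x).1 = (Z x).2⁻¹ • (Z x).1 := by
        rw [smul_smul, mul_inv]
        congr 1
        field_simp
      rw [h2]
      exact h1
  refine ⟨fun x => s • (Z x).1, fun x => s * (Z x).2, s, hs, hgd, hΩ'c, hΩ'b, hus,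
    hZ2.continuousOn.const_smul s, ?_, ?_, ?_, ?_⟩
  · intro x hx
    rw [hfr] at hx
    have h1 := hbdry _ hx
    have h2 : u (e x) • N₀ ∈ P.direction := by
      have h3 := AffineSubspace.vsub_mem_direction h1 hp₀
      rw [graphMap, vsub_eq_sub, add_assoc, add_sub_cancel_left] at h3
      exact (Submodule.add_mem_iff_right _ (e x).2).1 h3
    have h3 := hN₀.normal _ h2
    rw [mdot_smul_right, hN₀.unit] at h3
    change u (e x) = 0
    linarith
  · intro x hx
    have h1 := hsq x (frontier_subset_closure hx)
    rw [hfr] at hx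
    have h2 := hθ _ hx
    have h3 : N₀ = Φ (0, 1) := by rw [hΦ]; simp
    rw [hZN, h3, hΦm] at h2
    simp only [mdot, inner_zero_right, zero_sub, mul_one] at h2
    have h4 : 0 ≤ s * (Z x).2 := by rw [h1]; positivity
    change s * (Z x).2 = |θ₀|
    rw [← abs_of_nonneg h4, ← h2, abs_neg, abs_mul]
    rcases hs with rfl | rfl <;> simp
  · intro x hx
    have h1 := hH _ (subset_closure hx : e x ∈ closure Ω)
    have hbin : (n.choose k : ℝ) ≠ 0 := by exact_mod_cast (Nat.choose_pos hkn).ne'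
    rw [meanCurvature, div_eq_iff hbin, principalCurvatures,
      (normal_coordinates hΩ hΦ hΦm hu hN hx).2, LinearEquiv.charpoly_conj] at h1
    obtain ⟨b, l, hb, -, -⟩ := hgd.exists_eigenbasis finrank_euclideanSpace_fin hx
    have hd : fderiv ℝ (fun x => s • (Z x).1) x = s • fderiv ℝ (fun x => (Z x).1) x :=
      fderiv_fun_const_smul (((hZ1.mono subset_closure).contDiffAt
        (hΩ'o.mem_nhds hx)).differentiableAt (by simp)) s
    have hb' : ∀ i, fderiv ℝ (fun x => (Z x).1) x (b i) = (s * l i) • b i := by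
      intro i
      have := hb i
      rw [hd, smul_apply] at this
      rw [mul_smul, ← this, smul_smul, hss, one_smul]
    rw [charpoly_roots_of_eigenbasis b hb', ← opSigma_of_eigenbasis b hb'] at h1
    rw [hd, opSigma_smul, h1]
  · refine exists_bound_fderiv_of_contDiffOn_closure hΩ'o hΩ'b.isCompact_closure ?_
    exact (hZ1.const_smul s).of_le (by simp)

end Transfer

theorem theorem1 (n k : ℕ) (hk : 1 ≤ k) (hkn : k ≤ n)
    (P : AffineSubspace ℝ (Mink n)) (hP : IsSpacelikeHyperplane P)
    (N₀ : Mink n) (hN₀ : IsTimelikeUnitNormal P N₀) (p₀ : Mink n) (hp₀ : p₀ ∈ P)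
    (Ω : Set P.direction) (hΩ : IsSmoothBoundedDomain Ω)
    (u : P.direction → ℝ) (hu : ContDiffOn ℝ ∞ u (closure Ω))
    (M : Set (Mink n)) (hM : M = graphMap p₀ N₀ u '' closure Ω)
    (hspace : IsSpacelikeOn (graphMap p₀ N₀ u) (closure Ω))
    (N : P.direction → Mink n) (hN : IsUnitNormalField (graphMap p₀ N₀ u) N (closure Ω))
    (H : ℝ) (hH : ∀ x ∈ closure Ω, meanCurvature k (graphMap p₀ N₀ u) N (closure Ω) x = H)
    (hbdry : ∀ x ∈ frontier Ω, graphMap p₀ N₀ u x ∈ P)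
    (θ₀ : ℝ) (hθ : ∀ x ∈ frontier Ω, mdot (N x) N₀ = θ₀) :
    M ⊆ P ∨
      ∃ (a : P.direction) (r ε : ℝ), 0 < r ∧ (ε = 1 ∨ ε = -1) ∧ |H| * r ^ k = 1 ∧
        M ⊆ hyperboloid (p₀ + (a : Mink n) - (ε * r * |θ₀|) • N₀) r ∧
        Ω = {x : P.direction |
          mdot ((x - a : P.direction) : Mink n) ((x - a : P.direction) : Mink n)
            < r ^ 2 * (θ₀ ^ 2 - 1)} ∧
        ∀ x ∈ closure Ω,
          u x = ε * (√(r ^ 2 +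
            mdot ((x - a : P.direction) : Mink n) ((x - a : P.direction) : Mink n)) -
              r * |θ₀|) := by
  obtain ⟨e, he⟩ := hP.exists_isometry
  obtain ⟨Φ, hΦ, hΦm⟩ := hN₀.exists_lorentz e he
  obtain ⟨F, q, s, hs, hg⟩ := exists_isCappedGraph hkn hN₀ hp₀ hΩ.isOpen hΩ.isConnected
    hΩ.isBounded hΦ hΦm hu hN hH hbdry hθ
  obtain ⟨j, rfl⟩ : ∃ j, k = j + 1 := ⟨k - 1, by omega⟩
  have hfin : Module.finrank ℝ (EuclideanSpace ℝ (Fin n)) = n := finrank_euclideanSpace_fin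
  have hbin : (0 : ℝ) < n.choose (j + 1) := by exact_mod_cast Nat.choose_pos hkn
  have hn : ∀ x y : P.direction, mdot ((x - y : P.direction) : Mink n)
      ((x - y : P.direction) : Mink n) = ‖e.symm x - e.symm y‖ ^ 2 := by
    intro x y
    rw [← real_inner_self_eq_norm_sq, ← he, map_sub, e.apply_symm_apply, e.apply_symm_apply]
  -- Reduction of the second alternative to the graph of `ε u` in Lorentz coordinates.
  have concl : ∀ ε : ℝ, (ε = 1 ∨ ε = -1) → ∀ (K r : ℝ) (a : EuclideanSpace ℝ (Fin n)),
      |K| = |H| * n.choose (j + 1) → 0 < r → K * r ^ (j + 1) = n.choose (j + 1) →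
      e ⁻¹' Ω = {x | ‖x - a‖ ^ 2 < r ^ 2 * (|θ₀| ^ 2 - 1)} →
      (∀ x ∈ closure (e ⁻¹' Ω), ε * u (e x) = √(r ^ 2 + ‖x - a‖ ^ 2) - r * |θ₀|) →
      ∃ (a : P.direction) (r ε : ℝ), 0 < r ∧ (ε = 1 ∨ ε = -1) ∧ |H| * r ^ (j + 1) = 1 ∧
        M ⊆ hyperboloid (p₀ + (a : Mink n) - (ε * r * |θ₀|) • N₀) r ∧
        Ω = {x : P.direction |
          mdot ((x - a : P.direction) : Mink n) ((x - a : P.direction) : Mink n)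
            < r ^ 2 * (θ₀ ^ 2 - 1)} ∧
        ∀ x ∈ closure Ω,
          u x = ε * (√(r ^ 2 +
            mdot ((x - a : P.direction) : Mink n) ((x - a : P.direction) : Mink n)) -
              r * |θ₀|) := by
    intro ε hε K r a hKH hr hKr hΩa hua
    have hεε : ε * ε = 1 := by rcases hε with rfl | rfl <;> norm_num
    have hux : ∀ x ∈ closure Ω,
        u x = ε * (√(r ^ 2 + ‖e.symm x - a‖ ^ 2) - r * |θ₀|) := by
      intro x hx
      have hx' : e.symm x ∈ closure (e ⁻¹' Ω) := by
        have h1 : closure (e ⁻¹' Ω) = e ⁻¹' closure Ω :=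
          (e.toHomeomorph.preimage_closure Ω).symm
        rw [h1]
        simpa using hx
      rw [← hua _ hx', e.apply_symm_apply, ← mul_assoc, hεε, one_mul]
    refine ⟨e a, r, ε, hr, hε, ?_, ?_, ?_, ?_⟩
    · have h1 : |K| * r ^ (j + 1) = n.choose (j + 1) := by
        have h2 : |K * r ^ (j + 1)| = n.choose (j + 1) := by rw [hKr, abs_of_pos hbin]
        rwa [abs_mul, abs_of_pos (pow_pos hr _)] at h2
      rw [hKH] at h1
      refine mul_left_cancel₀ hbin.ne' ?_
      linarith
    · rw [hM]
      rintro _ ⟨x, hx, rfl⟩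
      have h1 : graphMap p₀ N₀ u x - (p₀ + (e a : Mink n) - (ε * r * |θ₀|) • N₀) =
          Φ (e.symm x - a, u x + ε * r * |θ₀|) := by
        rw [hΦ, map_sub, e.apply_symm_apply, graphMap, add_smul, Submodule.coe_sub]
        abel
      have h2 : u x + ε * r * |θ₀| = ε * √(r ^ 2 + ‖e.symm x - a‖ ^ 2) := by
        rw [hux x hx]; ring
      rw [hyperboloid, Set.mem_ofPred_eq, h1, hΦm, mdot, real_inner_self_eq_norm_sq, h2]
      have h3 := Real.mul_self_sqrt (show 0 ≤ r ^ 2 + ‖e.symm x - a‖ ^ 2 by positivity)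
      linear_combination (-(ε * ε)) * h3 - (r ^ 2 + ‖e.symm x - a‖ ^ 2) * hεε
    · ext x
      have h1 := Set.ext_iff.1 hΩa (e.symm x)
      rw [Set.mem_preimage, e.apply_symm_apply, Set.mem_ofPred_eq, sq_abs] at h1
      rw [h1, Set.mem_ofPred_eq, hn, e.symm_apply_apply]
    · intro x hx
      rw [hux x hx, hn, e.symm_apply_apply]
  have hsk : |s ^ (j + 1) * (H * n.choose (j + 1))| = |H| * n.choose (j + 1) := by
    rw [abs_mul, abs_pow, abs_mul, abs_of_pos hbin]
    rcases hs with rfl | rfl <;> simp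
  by_cases hneg : ∃ x, e x ∈ Ω ∧ u (e x) < 0
  · right
    obtain ⟨x₀, hx₀, hux₀⟩ := hneg
    obtain ⟨a, r, hr, hK, hΩa, hua⟩ := hg.exists_hyperboloid (by rwa [hfin]) hx₀ hux₀
    rw [hfin] at hK
    exact concl 1 (Or.inl rfl) _ r a hsk hr hK hΩa fun x hx => by rw [one_mul]; exact hua x hx
  by_cases hpos : ∃ x, e x ∈ Ω ∧ 0 < u (e x)
  · right
    obtain ⟨x₀, hx₀, hux₀⟩ := hpos
    obtain ⟨a, r, hr, hK, hΩa, hua⟩ := hg.neg.exists_hyperboloid (by rwa [hfin]) hx₀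
      (neg_lt_zero.2 hux₀)
    rw [hfin] at hK
    refine concl (-1) (Or.inr rfl) _ r a ?_ hr hK hΩa fun x hx => by
      rw [neg_one_mul]; exact hua x hx
    rw [abs_mul, hsk, abs_pow, abs_neg, abs_one, one_pow, one_mul]
  · left
    push Not at hneg hpos
    have h0 : ∀ x ∈ closure Ω, u x = 0 := by
      have : Set.EqOn u (fun _ => 0) Ω := fun x hx => by
        have h1 := hneg (e.symm x)
        have h2 := hpos (e.symm x)
        rw [e.apply_symm_apply] at h1 h2
        exact le_antisymm (h2 hx) (h1 hx)
      exact this.of_subset_closure hu.continuousOn continuousOn_const subset_closure le_rfl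
    rw [hM]
    rintro _ ⟨x, hx, rfl⟩
    rw [graphMap, h0 x hx, zero_smul, add_zero, add_comm]
    exact AffineSubspace.vadd_mem_of_mem_direction x.2 hp₀
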